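/- **Setting.** Let $E_0(t)=t$, $E_{m+1}(t)=e^{E_m(t)}$, $L_{-1}(t)=e^t$, $L_0(t)=t$, $L_{m+1}(t)=\ln L_m(t)$, and for $k\in\mathbb Z_+=\{0,1,2,\dots\}$ let $\widehat{\mathcal L}_k(t)=(e^t,t,\ln t,\dots,L_k(t))$, $t>E_k(0)$. For $z=(z_{-1},\dots,z_k)\in(0,\infty)^{k+2}$ and $\alpha\in\mathbb C^{k+2}$ put $z^\alpha=\prod_{j=-1}^k z_j^{\alpha_j}$. For $\mu\in\mathbb R$, $\mathscr P_0(k,\mu,\mathbb C^n)$ is the set of functions $p(z)=\sum_{\alpha\in S}z^\alpha\xi_\alpha$ on $(0,\infty)^{k+2}$ with $S$ a finite set of $\alpha\in\mathbb C^{k+2}$ satisfying $\Re\alpha_{-1}=0$, $\Re\alpha_0=\mu$, and $\xi_\alpha\in\mathbb C^n$; and $\mathscr F_0(k,\mu,\mathbb C^n)=\{p\circ\widehat{\mathcal L}_k:p\in\mathscr P_0(k,\mu,\mathbb C^n)\}$. If $k\le l$, a function of $(z_{-1},\dots,z_k)$ is also regarded as a function of $(z_{-1},\dots,z_l)$. For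 $p$ of the above form define $$(\mathcal M_jp)(z)=\sum_{\alpha\in S}\alpha_jz^\alpha\xi_\alpha,\qquad (\mathcal Rp)(z)=\sum_{j=0}^k z_0^{-1}z_1^{-1}\cdots z_j^{-1}(\mathcal M_jp)(z),\qquad (\mathcal Z_Ap)(z)=\sum_{\alpha\in S}z^\alpha(A+\alpha_{-1}I_n)^{-1}\xi_\alpha .$$ Let $(\mu_k)_{k\ge1}$ be a strictly increasing, divergent sequence of positive numbers and $(n_k)_{k\ge1}$ a sequence in $\mathbb Z_+$. We write $g(t)\sim\sum_{k=1}^\infty g_k(t)$ with $g_k\in\mathscr F_0(n_k,-\mu_k,\mathbb C^n)$ if for each $N\ge1$ there is $\rho>\mu_N$ such that $\big|g(t)-\sum_{k=1}^Ng_k(t)\big|=\mathcal O(t^{-\rho})$ as $t\to\infty$. **Assumptions.** Let $A$ be a complex $n\times n$ matrix all of whose eigenvalues have positive real parts. Let $G:\mathbb C^n\to\mathbb C^n$ be locally Lipschitz, and let $G_m:\mathbb C^n\to\mathbb C^n$, $m\ge2$, be homogeneous (complex) polynomial maps of degree $m$ (possibly zero) such that for every $N\ge2$ there is $\delta>0$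 with $|G(x)-\sum_{m=2}^NG_m(x)|=\mathcal O(|x|^{N+\delta})$ as $x\to0$. Let $f$ be a $\mathbb C^n$-valued function that is continuous on $[T_f,\infty)$ for some $T_f\ge0$ and satisfies $f(t)\sim\sum_{k=1}^\infty f_k(t)$ with $f_k\in\mathscr F_0(n_k,-\mu_k,\mathbb C^n)$, where $(\mu_k)$ is strictly increasing, divergent and positive, $(n_k)$ is nondecreasing in $\mathbb Z_+$, and the set $\{\mu_k:k\ge1\}$ is closed under addition and under $x\mapsto x+1$. Let $y\in C^1((T_0,\infty),\mathbb C^n)$, for some $T_0\ge0$, be a solution of $$y'=-Ay+G(y)+f(t)\quad\text{on }(T_0,\infty),\qquad y(t)\to0\ \text{ as }t\to\infty .$$ **Theorem.** There exist $y_k\in\mathscr F_0(n_k,-\mu_k,\mathbb C^n)$, $k\ge1$, such that $y(t)\sim\sum_{k=1}^\infty y_k(t)$. More specifically, let $\mathcal G_m:(\mathbb C^n)^m\to\mathbb C^n$ be any $m$-linear maps with $G_m(x)=\mathcal G_m(x,\dots,x)$, $m\ge2$, and let $f_k=p_k\circ\widehat{\mathcal L}_{n_k}$ with $p_k\in\mathscr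 P_0(n_k,-\mu_k,\mathbb C^n)$ for all $k\ge1$. Then there are functions $q_k$ on $(0,\infty)^{n_k+2}$ that satisfy the recursion, for all $k\ge1$, $$q_k=\mathcal Z_A\Big(\sum_{m\ge2}\ \sum_{\mu_{j_1}+\cdots+\mu_{j_m}=\mu_k}\mathcal G_m(q_{j_1},\dots,q_{j_m})+p_k-\chi_k\Big),\qquad \chi_k=\begin{cases}\mathcal Rq_\lambda&\text{if }\mu_\lambda+1=\mu_k\text{ for some }\lambda\le k-1,\\0&\text{otherwise,}\end{cases}$$ where the double sum is over the finitely many $m\ge2$ and $(j_1,\dots,j_m)\in\mathbb N^m$ with $\mu_{j_1}+\cdots+\mu_{j_m}=\mu_k$. Moreover, whenever the $q_k$ satisfy this recursion, $q_k\in\mathscr P_0(n_k,-\mu_k,\mathbb C^n)$ for all $k\ge1$, and $y(t)\sim\sum_{k=1}^\infty q_k(\widehat{\mathcal L}_{n_k}(t))$. -/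

import Mathlib

open Filter Topology Asymptotics

namespace PowerDecay

noncomputable section

/-! ### Iterated exponentials and logarithms -/

/-- `iterExp m t` is `E_m(t)`: `E_0(t) = t` and `E_{m+1}(t) = exp (E_m(t))`. -/
def iterExp : ℕ → ℝ → ℝ
  | 0, t => t
  | m + 1, t => Real.exp (iterExp m t)

/-- `iterLog m t` is `L_m(t)` for `m ≥ 0`: `L_0(t) = t` and `L_{m+1}(t) = ln (L_m(t))`.
It is only used for `t > E_m(0)`, where it is positive. -/
def iterLog : ℕ → ℝ → ℝ
  | 0, t => t
  | m + 1, t => Real.log (iterLog m t)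

/-- `logVec k t = (e^t, t, ln t, …, L_k(t))`, the vector with the `k + 2` components
`L_{-1}(t), L_0(t), …, L_k(t)`. A position `j : Fin (k + 2)` stands for the index `j - 1`
in the numbering from `-1` to `k`; the same convention is used for all vectors below. -/
def logVec (k : ℕ) (t : ℝ) : Fin (k + 2) → ℝ :=
  Fin.cons (Real.exp t) (fun j : Fin (k + 1) => iterLog j t)

/-! ### Power functions of several variables with complex exponents -/

/-- The set `(0, ∞)^{k+2}`. Functions in the classes below are regarded as functions on this set:
their values elsewhere are irrelevant. -/
def posOrthant (k : ℕ) : Set (Fin (k + 2) → ℝ) := {z | ∀ j, 0 < z j}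

/-- `vecPow z α = ∏_j z_j ^ α_j`. -/
def vecPow {k : ℕ} (z : Fin (k + 2) → ℝ) (α : Fin (k + 2) → ℂ) : ℂ :=
  ∏ j, (z j : ℂ) ^ (α j)

/-- The set of exponents `α = (α_{-1}, …, α_k)` with `Re α_j = 0` for `-1 ≤ j < m` and
`Re α_m = μ` (for `-1 ≤ m ≤ k`). -/
def expSet (m : ℤ) (k : ℕ) (μ : ℝ) : Set (Fin (k + 2) → ℂ) :=
  {α | ∀ j : Fin (k + 2), ((j : ℤ) - 1 < m → (α j).re = 0) ∧ ((j : ℤ) - 1 = m → (α j).re = μ)}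

section classes

variable {X : Type*} [AddCommGroup X] [Module ℂ X]

/-- The function `z ↦ ∑_α z^α ξ_α`, for a finitely supported family of coefficients `ξ = c`. -/
def evalPow {k : ℕ} (c : (Fin (k + 2) → ℂ) →₀ X) (z : Fin (k + 2) → ℝ) : X :=
  c.sum fun α ξ => vecPow z α • ξ

variable (X) in
/-- The class `𝒫_m(k, μ, X)`: functions `p(z) = ∑_{α ∈ S} z^α ξ_α` on `(0, ∞)^{k+2}` with `S` a
finite subset of `expSet m k μ` and `ξ_α ∈ X`. -/
def PClass (m : ℤ) (k : ℕ) (μ : ℝ) : Set ((Fin (k + 2) → ℝ) → X) :=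
  {p | ∃ (S : Finset (Fin (k + 2) → ℂ)) (ξ : (Fin (k + 2) → ℂ) → X),
    (∀ α ∈ S, α ∈ expSet m k μ) ∧
      ∀ z ∈ posOrthant k, p z = ∑ α ∈ S, vecPow z α • ξ α}

variable (X) in
/-- The class `ℱ_m(k, μ, X)`: functions of `t > E_k(0)` of the form `p (logVec k t)` with `p` in
`𝒫_m(k, μ, X)`. -/
def FClass (m : ℤ) (k : ℕ) (μ : ℝ) : Set (ℝ → X) :=
  {g | ∃ p ∈ PClass X m k μ, ∀ t, iterExp k 0 < t → g t = p (logVec k t)}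

open Classical in
/-- The coefficients `α ↦ ξ_α` of a function `p(z) = ∑_α z^α ξ_α` on `(0, ∞)^{k+2}`; they are
unique by `coeffs_eq` below. (The value is `0` if `p` is not of this form.) -/
def coeffs {k : ℕ} (p : (Fin (k + 2) → ℝ) → X) : (Fin (k + 2) → ℂ) →₀ X :=
  if h : ∃ c : (Fin (k + 2) → ℂ) →₀ X, ∀ z ∈ posOrthant k, p z = evalPow c z
  then h.choose else 0

/-- `(ℳ_j p)(z) = ∑_α α_j z^α ξ_α` for `p(z) = ∑_α z^α ξ_α`. -/
def opM {k : ℕ} (j : Fin (k + 2)) (p : (Fin (k + 2) → ℝ) → X) : (Fin (k + 2) → ℝ) → X :=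
  fun z => (coeffs p).sum fun α ξ => α j • vecPow z α • ξ

/-- `(ℛ p)(z) = ∑_{j=0}^k z_0⁻¹ z_1⁻¹ ⋯ z_j⁻¹ (ℳ_j p)(z)`; here the index `j` of the mathematics
is at position `j + 1`. -/
def opR {k : ℕ} (p : (Fin (k + 2) → ℝ) → X) : (Fin (k + 2) → ℝ) → X :=
  fun z => ∑ j : Fin (k + 1), (∏ i ∈ Finset.Iic j, (z i.succ)⁻¹) • opM j.succ p z

/-- A function of `(z_{-1}, …, z_k)` regarded as a function of `(z_{-1}, …, z_l)`, for `k ≤ l`, that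
does not depend on the additional variables. (For `l < k`, which does not occur, the missing
variables are set to `1`.) -/
def liftVar {k : ℕ} (l : ℕ) (p : (Fin (k + 2) → ℝ) → X) : (Fin (l + 2) → ℝ) → X :=
  fun z => p fun j => if h : (j : ℕ) < l + 2 then z ⟨j, h⟩ else 1

end classes

/-- `(𝒵_A p)(z) = ∑_α z^α (A + α_{-1} I)⁻¹ ξ_α` for `p(z) = ∑_α z^α ξ_α`. -/
def opZ {n k : ℕ} (A : Matrix (Fin n) (Fin n) ℂ)
    (p : (Fin (k + 2) → ℝ) → EuclideanSpace ℂ (Fin n)) :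
    (Fin (k + 2) → ℝ) → EuclideanSpace ℂ (Fin n) :=
  fun z => (coeffs p).sum fun α ξ =>
    vecPow z α • Matrix.toEuclideanLin (A + α 0 • (1 : Matrix (Fin n) (Fin n) ℂ))⁻¹ ξ

/-! ### Uniqueness of the coefficients: the operators are well defined -/

/-- The function `s ↦ (e^{s})^α` as a character of the additive group `ℝ^{k+2}`. -/
def expChar {k : ℕ} (α : Fin (k + 2) → ℂ) : Multiplicative (Fin (k + 2) → ℝ) →* ℂ where
  toFun s := Complex.exp (∑ j, (Multiplicative.toAdd s j : ℂ) * α j)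
  map_one' := by simp
  map_mul' s t := by
    rw [← Complex.exp_add, ← Finset.sum_add_distrib]
    congr 1
    refine Finset.sum_congr rfl fun j _ => ?_
    simp [add_mul]

lemma expChar_injective (k : ℕ) :
    Function.Injective (expChar : (Fin (k + 2) → ℂ) → _) := by
  intro α β h
  funext j
  have h1 : ∀ r : ℝ, Complex.exp ((r : ℂ) * α j) = Complex.exp ((r : ℂ) * β j) := by
    intro r
    have := DFunLike.congr_fun h (Multiplicative.ofAdd (Pi.single j r))
    simpa [expChar, Pi.single_apply, apply_ite, ite_mul] using this
  have hd : ∀ c : ℂ, HasDerivAt (fun r : ℝ => Complex.exp ((r : ℂ) * c)) c 0 := by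
    intro c
    have h2 : HasDerivAt (fun r : ℝ => (r : ℂ) * c) (1 * c) 0 :=
      (Complex.ofRealCLM.hasDerivAt (x := (0 : ℝ))).mul_const c
    simpa using h2.cexp
  exact ((hd (α j)).congr_of_eventuallyEq
    (Filter.Eventually.of_forall fun r => (h1 r).symm)).unique (hd (β j))

lemma vecPow_exp {k : ℕ} (s : Fin (k + 2) → ℝ) (α : Fin (k + 2) → ℂ) :
    vecPow (fun j => Real.exp (s j)) α = expChar α (Multiplicative.ofAdd s) := by
  simp only [vecPow, expChar, MonoidHom.coe_mk, OneHom.coe_mk, toAdd_ofAdd, Complex.exp_sum]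
  refine Finset.prod_congr rfl fun j _ => ?_
  rw [Complex.cpow_def_of_ne_zero (by exact_mod_cast (Real.exp_pos _).ne'),
    ← Complex.ofReal_log (Real.exp_pos _).le, Real.log_exp]

lemma evalPow_injOn {X : Type*} [AddCommGroup X] [Module ℂ X] {k : ℕ}
    {c d : (Fin (k + 2) → ℂ) →₀ X}
    (h : ∀ z ∈ posOrthant k, evalPow c z = evalPow d z) : c = d := by
  classical
  have hli : LinearIndependent ℂ (fun α : Fin (k + 2) → ℂ =>
      (expChar α : Multiplicative (Fin (k + 2) → ℝ) → ℂ)) :=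
    (linearIndependent_monoidHom (Multiplicative (Fin (k + 2) → ℝ)) ℂ).comp _
      (expChar_injective k)
  rw [← sub_eq_zero]
  set e := c - d with he
  have hz : ∀ z ∈ posOrthant k, evalPow e z = 0 := by
    intro z hzz
    rw [he, evalPow, Finsupp.sum_sub_index (by intros; rw [smul_sub])]
    exact sub_eq_zero.2 (h z hzz)
  ext α
  rw [Finsupp.zero_apply, ← Module.forall_dual_apply_eq_zero_iff ℂ]
  intro φ
  have hl := (linearIndependent_iff.1 hli) (e.mapRange φ (map_zero φ)) (by
    ext s
    have h0 := congrArg φ (hz (fun j => Real.exp (Multiplicative.toAdd s j))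
      (fun j => Real.exp_pos _))
    rw [Finsupp.linearCombination_apply, Finsupp.sum_mapRange_index (by simp)]
    simp only [evalPow, Finsupp.sum, map_sum, map_smul, map_zero, vecPow_exp, ofAdd_toAdd] at h0
    simpa [Finsupp.sum, mul_comm] using h0)
  simpa using DFunLike.congr_fun hl α

section welldef

variable {X : Type*} [AddCommGroup X] [Module ℂ X]

lemma coeffs_eq {k : ℕ} {p : (Fin (k + 2) → ℝ) → X} {c : (Fin (k + 2) → ℂ) →₀ X}
    (h : ∀ z ∈ posOrthant k, p z = evalPow c z) : coeffs p = c := by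
  have hex : ∃ c : (Fin (k + 2) → ℂ) →₀ X, ∀ z ∈ posOrthant k, p z = evalPow c z := ⟨c, h⟩
  rw [coeffs, dif_pos hex]
  exact evalPow_injOn fun z hz => (hex.choose_spec z hz).symm.trans (h z hz)

open Classical in
lemma coeffs_eq_sum {k : ℕ} {p : (Fin (k + 2) → ℝ) → X} {S : Finset (Fin (k + 2) → ℂ)}
    {ξ : (Fin (k + 2) → ℂ) → X}
    (h : ∀ z ∈ posOrthant k, p z = ∑ α ∈ S, vecPow z α • ξ α) :
    coeffs p = Finsupp.onFinset S (fun α => if α ∈ S then ξ α else 0)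
      (fun α hα => by by_contra hS; simp [hS] at hα) := by
  refine coeffs_eq fun z hz => ?_
  rw [h z hz, evalPow, Finsupp.onFinset_sum _ (by simp)]
  exact Finset.sum_congr rfl fun α hα => by simp [hα]

lemma opM_eq_sum {k : ℕ} {p : (Fin (k + 2) → ℝ) → X} {S : Finset (Fin (k + 2) → ℂ)}
    {ξ : (Fin (k + 2) → ℂ) → X}
    (h : ∀ z ∈ posOrthant k, p z = ∑ α ∈ S, vecPow z α • ξ α) (j : Fin (k + 2))
    (z : Fin (k + 2) → ℝ) :
    opM j p z = ∑ α ∈ S, α j • vecPow z α • ξ α := by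
  classical
  rw [opM, coeffs_eq_sum h, Finsupp.onFinset_sum _ (by simp)]
  exact Finset.sum_congr rfl fun α hα => by simp [hα]

lemma opZ_eq_sum {n k : ℕ} (A : Matrix (Fin n) (Fin n) ℂ)
    {p : (Fin (k + 2) → ℝ) → EuclideanSpace ℂ (Fin n)} {S : Finset (Fin (k + 2) → ℂ)}
    {ξ : (Fin (k + 2) → ℂ) → EuclideanSpace ℂ (Fin n)}
    (h : ∀ z ∈ posOrthant k, p z = ∑ α ∈ S, vecPow z α • ξ α) (z : Fin (k + 2) → ℝ) :
    opZ A p z = ∑ α ∈ S, vecPow z α •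
      Matrix.toEuclideanLin (A + α 0 • (1 : Matrix (Fin n) (Fin n) ℂ))⁻¹ (ξ α) := by
  classical
  rw [opZ, coeffs_eq_sum h, Finsupp.onFinset_sum _ (by simp)]
  exact Finset.sum_congr rfl fun α hα => by simp [hα]

end welldef

/-! ### Asymptotic expansions -/

/-- The asymptotic expansion `g(t) ∼ ∑_k g_k(t)` with `g_k ∈ ℱ_m(ν_k, -γ_k, X)`, where `(γ_k)` is a
divergent, strictly increasing sequence of positive numbers: for each `N` the remainder after the
terms up to index `N` is `O(L_m(t)^{-ρ})` for some `ρ > γ_N`. Sequences are indexed from `0`. -/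
structure HasExpansion {X : Type*} [NormedAddCommGroup X] [NormedSpace ℂ X] (m : ℕ)
    (ν : ℕ → ℕ) (γ : ℕ → ℝ) (g : ℝ → X) (gk : ℕ → ℝ → X) : Prop where
  pos : ∀ k, 0 < γ k
  strictMono : StrictMono γ
  tendsto : Tendsto γ atTop atTop
  le : ∀ k, m ≤ ν k
  mem : ∀ k, gk k ∈ FClass X (m : ℤ) (ν k) (-γ k)
  approx : ∀ N : ℕ, ∃ ρ : ℝ, γ N < ρ ∧
    (fun t => g t - ∑ k ∈ Finset.range (N + 1), gk k t) =O[atTop] fun t => iterLog m t ^ (-ρ)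

/-! ### The nonlinearity -/

/-- A map `ℂⁿ → ℂⁿ` whose components are homogeneous polynomials of degree `m` (or zero). -/
def IsHomogPolyMap {n : ℕ} (m : ℕ)
    (P : EuclideanSpace ℂ (Fin n) → EuclideanSpace ℂ (Fin n)) : Prop :=
  ∀ i, ∃ F : MvPolynomial (Fin n) ℂ, F.IsHomogeneous m ∧ ∀ x, P x i = MvPolynomial.eval x F

/-! ### The recursion -/

/-- The pairs `(m, (j_1, …, j_m))` with `m ≥ 2` and `μ_{j_1} + ⋯ + μ_{j_m} = μ_k`. -/
def tupleSet (μ : ℕ → ℝ) (k : ℕ) : Set (Σ m : ℕ, Fin m → ℕ) :=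
  {x | 2 ≤ x.1 ∧ ∑ i, μ (x.2 i) = μ k}

/-- The sum over `tupleSet` is a finite one. -/
lemma tupleSet_finite {μ : ℕ → ℝ} (hpos : ∀ k, 0 < μ k) (hmono : StrictMono μ) (k : ℕ) :
    (tupleSet μ k).Finite := by
  obtain ⟨M, hM⟩ := exists_nat_gt (μ k / μ 0)
  refine Set.Finite.subset (Set.finite_range
    (fun x : (Σ m : Fin M, Fin m → Fin (k + 1)) =>
      (⟨x.1, fun i => (x.2 i : ℕ)⟩ : Σ m : ℕ, Fin m → ℕ))) ?_
  rintro ⟨m, j⟩ ⟨-, hs⟩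
  simp only at hs
  have h1 : (m : ℝ) * μ 0 ≤ μ k := by
    rw [← hs]
    calc (m : ℝ) * μ 0 = ∑ _i : Fin m, μ 0 := by simp
      _ ≤ _ := Finset.sum_le_sum fun i _ => hmono.monotone (Nat.zero_le _)
  have h2 : m < M := by
    have : (m : ℝ) < M := ((le_div_iff₀ (hpos 0)).2 h1).trans_lt hM
    exact_mod_cast this
  have h3 : ∀ i, j i < k + 1 := fun i => by
    have : μ (j i) ≤ μ k := by
      rw [← hs]
      exact Finset.single_le_sum (f := fun i => μ (j i)) (fun i _ => (hpos _).le)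
        (Finset.mem_univ i)
    exact Nat.lt_succ_of_le (hmono.le_iff_le.1 this)
  exact ⟨⟨⟨m, h2⟩, fun i => ⟨j i, h3 i⟩⟩, rfl⟩

section recursion

variable {n : ℕ}

/-- `∑_{m ≥ 2} ∑_{μ_{j_1} + ⋯ + μ_{j_m} = μ_k} 𝒢_m(q_{j_1}, …, q_{j_m})` as a function on
`(0, ∞)^{ν_k + 2}`. -/
def nonlinTerm (ν : ℕ → ℕ) (μ : ℕ → ℝ)
    (𝒢 : ∀ m : ℕ, MultilinearMap ℂ (fun _ : Fin m => EuclideanSpace ℂ (Fin n))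
      (EuclideanSpace ℂ (Fin n)))
    (q : ∀ k : ℕ, (Fin (ν k + 2) → ℝ) → EuclideanSpace ℂ (Fin n)) (k : ℕ) :
    (Fin (ν k + 2) → ℝ) → EuclideanSpace ℂ (Fin n) :=
  fun z => ∑ᶠ x ∈ tupleSet μ k, 𝒢 x.1 fun i => liftVar (ν k) (q (x.2 i)) z

open Classical in
/-- `χ_k = ℛ q_l` if there is `l < k` (necessarily unique) with `μ_l + 1 = μ_k`, and `χ_k = 0`
otherwise. -/
def chiTerm (ν : ℕ → ℕ) (μ : ℕ → ℝ)
    (q : ∀ k : ℕ, (Fin (ν k + 2) → ℝ) → EuclideanSpace ℂ (Fin n)) (k : ℕ) :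
    (Fin (ν k + 2) → ℝ) → EuclideanSpace ℂ (Fin n) :=
  if h : ∃ l < k, μ l + 1 = μ k then liftVar (ν k) (opR (q h.choose)) else 0

/-- The recursive relations
`q_k = 𝒵_A (∑_{m ≥ 2} ∑_{μ_{j_1} + ⋯ + μ_{j_m} = μ_k} 𝒢_m(q_{j_1}, …, q_{j_m}) + p_k - χ_k)`
on `(0, ∞)^{ν_k + 2}`, for all `k`. -/
def SatisfiesRecursion (A : Matrix (Fin n) (Fin n) ℂ) (ν : ℕ → ℕ) (μ : ℕ → ℝ)
    (𝒢 : ∀ m : ℕ, MultilinearMap ℂ (fun _ : Fin m => EuclideanSpace ℂ (Fin n))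
      (EuclideanSpace ℂ (Fin n)))
    (p q : ∀ k : ℕ, (Fin (ν k + 2) → ℝ) → EuclideanSpace ℂ (Fin n)) : Prop :=
  ∀ k, ∀ z ∈ posOrthant (ν k),
    q k z = opZ A (fun w => nonlinTerm ν μ 𝒢 q k w + p k w - chiTerm ν μ q k w) z

end recursion

end

end PowerDecay

open PowerDecay

/-!
The solution `y` is compared directly with the truncations `s = ∑_{k ≤ N} q_k ∘ logVec` of the
formal expansion.

Along `logVec` one has `L_{-1}' / L_{-1} = 1` and `L_j' / L_j = 1 / (L_0 ⋯ L_j)`, so that `(q ∘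
logVec)' = (ℳ_{-1} q + ℛ q) ∘ logVec`. The recursion `q_k = 𝒵_A (⋯)` therefore says that each `q_k
∘ logVec` solves the linear equation `u' = -A u + (⋯ + ℛ q_k) ∘ logVec` (`hasDerivAt_opZ_logVec`).
Summing over `k ≤ N`, the terms `ℛ q_l` cancel against the `χ_k`, and the values `𝒢_m (q_{j_1}, …,
q_{j_m})` add up to the Taylor polynomial of `G` at `s`, in both cases up to terms whose order is
one of the `μ_k` with `k > N`, because `{μ_k}` is closed under addition and under `x ↦ x + 1`
(`isBigO_sum_opR_sub_sum_chiTerm`, `isBigO_diag_sub_sum_nonlinTerm`). A function of the class with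
exponent `-σ` is `O(t ^ (-σ + ε))` for every `ε > 0`, since logarithms grow more slowly than
powers (`PClass.isBigO`); hence `s` solves the differential equation up to `O(t ^ (-ρ))` for some
`ρ > μ_N`.

The difference `w = y - s` tends to zero and satisfies `w' = -A w + o(|w|) + O(t ^ (-ρ))`. The map
`G` need not have small Lipschitz constants near the origin, but its Taylor polynomials do, and
the Taylor remainder at `y` is either superlinear in `w` or bounded by a high power of `|s|`
(`exists_nonlinearity_split`). A Lyapunov norm for `A`, built from a power of `1 - h A` of small
norm by Gelfand's formula (`exists_lyapunov`), then gives `w = O(t ^ (-ρ))`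
(`isBigO_rpow_of_stable`).

The classes are stable under all operations in the recursion, which gives `q_k ∈ 𝒫_0(ν_k, -μ_k)`
by strong induction, and the existence of some expansion follows by choosing multilinear maps for
the homogeneous polynomials (`IsHomogPolyMap.exists_multilinear`).
-/

namespace PowerDecay

/-! ### Algebra of the classes of power functions -/

lemma vecPow_zero {k : ℕ} (z : Fin (k + 2) → ℝ) : vecPow z 0 = 1 := by simp [vecPow]

lemma vecPow_add {k : ℕ} {z : Fin (k + 2) → ℝ} (hz : z ∈ posOrthant k)
    (α β : Fin (k + 2) → ℂ) : vecPow z (α + β) = vecPow z α * vecPow z β := by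
  simp only [vecPow, ← Finset.prod_mul_distrib]
  exact Finset.prod_congr rfl fun j _ =>
    Complex.cpow_add _ _ (by exact_mod_cast (hz j).ne')

lemma vecPow_sum {k : ℕ} {z : Fin (k + 2) → ℝ} (hz : z ∈ posOrthant k) {ι : Type*}
    (s : Finset ι) (α : ι → Fin (k + 2) → ℂ) :
    vecPow z (∑ i ∈ s, α i) = ∏ i ∈ s, vecPow z (α i) := by
  classical
  induction s using Finset.induction_on with
  | empty => simp [vecPow_zero]
  | insert a s ha ih => rw [Finset.sum_insert ha, Finset.prod_insert ha, vecPow_add hz, ih]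

lemma liftVar_logVec {X : Type*} {k l : ℕ} (hkl : k ≤ l) (p : (Fin (k + 2) → ℝ) → X) (t : ℝ) :
    PowerDecay.liftVar l p (logVec l t) = p (logVec k t) := by
  unfold PowerDecay.liftVar
  congr 1
  funext j
  have : (j : ℕ) < l + 2 := by omega
  simp only [this, dite_true]
  obtain ⟨j, hj⟩ := j
  cases j <;> rfl

section classes

variable {X : Type*} [AddCommGroup X] [Module ℂ X]

lemma PClass.congr {m : ℤ} {k : ℕ} {μ : ℝ} {p p' : (Fin (k + 2) → ℝ) → X}
    (hp : p ∈ PClass X m k μ) (h : ∀ z ∈ posOrthant k, p' z = p z) : p' ∈ PClass X m k μ := by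
  obtain ⟨S, ξ, hS, hpS⟩ := hp
  exact ⟨S, ξ, hS, fun z hz => (h z hz).trans (hpS z hz)⟩

variable (X) in
/-- The class `𝒫_m(k, μ, X)` as a complex vector space of functions. -/
def PSubmodule (m : ℤ) (k : ℕ) (μ : ℝ) : Submodule ℂ ((Fin (k + 2) → ℝ) → X) where
  carrier := PClass X m k μ
  zero_mem' := ⟨∅, 0, by simp, by simp⟩
  add_mem' := by
    classical
    rintro p q ⟨S, ξ, hS, hp⟩ ⟨T, η, hT, hq⟩
    refine ⟨S ∪ T, fun α => (if α ∈ S then ξ α else 0) + if α ∈ T then η α else 0, ?_, ?_⟩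
    · intro α hα
      exact (Finset.mem_union.1 hα).elim (hS α) (hT α)
    · intro z hz
      have e1 : (S ∪ T).filter (· ∈ S) = S := by ext; simp
      have e2 : (S ∪ T).filter (· ∈ T) = T := by ext; simp
      simp only [smul_add, Finset.sum_add_distrib, smul_ite, smul_zero, ← Finset.sum_filter, e1, e2]
      rw [Pi.add_apply, hp z hz, hq z hz]
  smul_mem' := by
    rintro c p ⟨S, ξ, hS, hp⟩
    refine ⟨S, fun α => c • ξ α, hS, fun z hz => ?_⟩
    rw [Pi.smul_apply, hp z hz, Finset.smul_sum]
    exact Finset.sum_congr rfl fun α _ => smul_comm _ _ _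

/-- A finite sum of monomials lies in the class even if exponents are repeated. -/
lemma PClass.of_sum {m : ℤ} {k : ℕ} {μ : ℝ} {ι : Type*} (s : Finset ι)
    (α : ι → Fin (k + 2) → ℂ) (ξ : ι → X) (hα : ∀ i ∈ s, α i ∈ expSet m k μ)
    {p : (Fin (k + 2) → ℝ) → X}
    (hp : ∀ z ∈ posOrthant k, p z = ∑ i ∈ s, vecPow z (α i) • ξ i) : p ∈ PClass X m k μ := by
  refine PClass.congr (p := ∑ i ∈ s, fun z => vecPow z (α i) • ξ i) ?_ ?_
  · refine (PSubmodule X m k μ).sum_mem fun i hi => ?_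
    exact ⟨{α i}, fun _ => ξ i, by simpa using hα i hi, by simp⟩
  · intro z hz
    rw [hp z hz, Finset.sum_apply]

lemma mem_expSet_zero {k : ℕ} {μ : ℝ} {α : Fin (k + 2) → ℂ} :
    α ∈ expSet 0 k μ ↔ (α 0).re = 0 ∧ (α 1).re = μ := by
  constructor
  · intro h
    exact ⟨(h 0).1 (by simp), (h 1).2 (by simp)⟩
  · rintro ⟨h0, h1⟩ j
    refine ⟨fun hj => ?_, fun hj => ?_⟩
    · have : j = 0 := Fin.ext (show (j : ℕ) = 0 by omega)
      rwa [this]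
    · have : j = 1 := Fin.ext (by rw [Fin.val_one]; omega)
      rwa [this]

lemma PClass.of_eq {k : ℕ} {μ μ' : ℝ} (h : μ = μ') {p : (Fin (k + 2) → ℝ) → X}
    (hp : p ∈ PClass X 0 k μ) : p ∈ PClass X 0 k μ' := h ▸ hp

/-! ### Additional variables -/

/-- The exponent vector extended by zeros. -/
def extendExp {k : ℕ} (l : ℕ) (α : Fin (k + 2) → ℂ) : Fin (l + 2) → ℂ :=
  fun j => if h : (j : ℕ) < k + 2 then α ⟨j, h⟩ else 0

lemma vecPow_extendExp {k l : ℕ} (hkl : k ≤ l) (z : Fin (l + 2) → ℝ) (α : Fin (k + 2) → ℂ) :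
    vecPow z (extendExp l α) =
      vecPow (fun j : Fin (k + 2) => if h : (j : ℕ) < l + 2 then z ⟨j, h⟩ else 1) α := by
  have e : ∀ j : Fin (k + 2), (j : ℕ) < l + 2 := fun j => by omega
  unfold vecPow extendExp
  rw [← Finset.prod_subset (Finset.subset_univ
    (Finset.univ.map (Fin.castLEEmb (by omega : k + 2 ≤ l + 2)))), Finset.prod_map]
  · refine Finset.prod_congr rfl fun j _ => ?_
    simp [e j]
    rfl
  · intro j _ hj
    have : ¬ (j : ℕ) < k + 2 := fun h => hj (by
      simp only [Finset.mem_map, Finset.mem_univ, true_and]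
      exact ⟨⟨j, h⟩, rfl⟩)
    simp [this]

lemma restrict_mem_posOrthant {k l : ℕ} (hkl : k ≤ l) {z : Fin (l + 2) → ℝ}
    (hz : z ∈ posOrthant l) :
    (fun j : Fin (k + 2) => if h : (j : ℕ) < l + 2 then z ⟨j, h⟩ else 1) ∈ posOrthant k := by
  intro j
  have : (j : ℕ) < l + 2 := by omega
  simp only [this, dite_true]
  exact hz _

lemma PClass.liftVar {k l : ℕ} (hkl : k ≤ l) {μ : ℝ} {p : (Fin (k + 2) → ℝ) → X}
    (hp : p ∈ PClass X 0 k μ) : liftVar l p ∈ PClass X 0 l μ := by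
  obtain ⟨S, ξ, hS, hpS⟩ := hp
  refine PClass.of_sum S (extendExp l) ξ (fun α hα => ?_) fun z hz => ?_
  · have := mem_expSet_zero.1 (hS α hα)
    rw [mem_expSet_zero]
    simpa [extendExp] using this
  · rw [PowerDecay.liftVar, hpS _ (restrict_mem_posOrthant hkl hz)]
    simp only [vecPow_extendExp hkl]

/-! ### The operators on the classes -/

/-- A product of values of functions in the classes, in the sense of a multilinear map. -/
lemma PClass.multilinear {Y : Type*} [AddCommGroup Y] [Module ℂ Y] {k m : ℕ}
    (f : MultilinearMap ℂ (fun _ : Fin m => X) Y) {μ : Fin m → ℝ}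
    {p : Fin m → (Fin (k + 2) → ℝ) → X} (hp : ∀ i, p i ∈ PClass X 0 k (μ i)) :
    (fun z => f fun i => p i z) ∈ PClass Y 0 k (∑ i, μ i) := by
  classical
  choose S ξ hS hpS using hp
  refine PClass.of_sum (Fintype.piFinset S) (fun r => ∑ i, r i) (fun r => f fun i => ξ i (r i))
    (fun r hr => ?_) fun z hz => ?_
  · have h : ∀ i, r i ∈ expSet 0 k (μ i) := fun i => hS i _ (Fintype.mem_piFinset.1 hr i)
    simp only [mem_expSet_zero] at h
    rw [mem_expSet_zero]
    simp [Finset.sum_apply, (h _).1, (h _).2]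
  · simp only [hpS _ z hz]
    rw [f.map_sum_finset]
    refine Finset.sum_congr rfl fun r _ => ?_
    rw [f.map_smul_univ, vecPow_sum hz]

/-- The exponent vector of `z_0⁻¹ ⋯ z_j⁻¹`. -/
def invExp (k : ℕ) (j : Fin (k + 1)) : Fin (k + 2) → ℂ :=
  Fin.cons 0 fun i => if i ≤ j then -1 else 0

lemma vecPow_invExp {k : ℕ} (z : Fin (k + 2) → ℝ) (j : Fin (k + 1)) :
    vecPow z (invExp k j) = ((∏ i ∈ Finset.Iic j, (z i.succ)⁻¹ : ℝ) : ℂ) := by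
  rw [vecPow, Fin.prod_univ_succ]
  have : Finset.Iic j = Finset.univ.filter (· ≤ j) := by ext; simp
  rw [this, Finset.prod_filter]
  simp only [invExp, Fin.cons_zero, Fin.cons_succ, Complex.cpow_zero, one_mul, Complex.ofReal_prod]
  refine Finset.prod_congr rfl fun i _ => ?_
  split_ifs <;> simp [Complex.cpow_neg_one]

lemma opR_eq_sum {k : ℕ} {p : (Fin (k + 2) → ℝ) → X} {S : Finset (Fin (k + 2) → ℂ)}
    {ξ : (Fin (k + 2) → ℂ) → X}
    (h : ∀ z ∈ posOrthant k, p z = ∑ α ∈ S, vecPow z α • ξ α)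
    {z : Fin (k + 2) → ℝ} (hz : z ∈ posOrthant k) :
    opR p z = ∑ α ∈ S, ∑ j : Fin (k + 1), vecPow z (invExp k j + α) • α j.succ • ξ α := by
  rw [Finset.sum_comm]
  refine Finset.sum_congr rfl fun j _ => ?_
  rw [opM_eq_sum h, Finset.smul_sum]
  refine Finset.sum_congr rfl fun α _ => ?_
  rw [vecPow_add hz, vecPow_invExp, smul_comm (α j.succ), mul_smul]
  rfl

/-- The operator `ℛ` lowers the exponent of `z_0` by one, since each of its summands carries
exactly one factor `z_0⁻¹`. -/
lemma PClass.opR {k : ℕ} {μ : ℝ} {p : (Fin (k + 2) → ℝ) → X} (hp : p ∈ PClass X 0 k μ) :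
    opR p ∈ PClass X 0 k (μ - 1) := by
  obtain ⟨S, ξ, hS, hpS⟩ := hp
  refine PClass.of_sum (S ×ˢ (Finset.univ : Finset (Fin (k + 1)))) (fun x => invExp k x.2 + x.1)
    (fun x => x.1 x.2.succ • ξ x.1) (fun x hx => ?_) fun z hz => ?_
  · have := mem_expSet_zero.1 (hS x.1 (Finset.mem_product.1 hx).1)
    rw [mem_expSet_zero]
    have h1 : invExp k x.2 1 = -1 := by
      rw [← Fin.succ_zero_eq_one, invExp, Fin.cons_succ, if_pos (Fin.zero_le _)]
    have h0 : invExp k x.2 0 = 0 := rfl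
    simp only [Pi.add_apply, h0, h1, Complex.add_re, Complex.zero_re, Complex.neg_re,
      Complex.one_re, this.1, this.2]
    exact ⟨by ring, by ring⟩
  · rw [opR_eq_sum hpS hz, Finset.sum_product]

end classes

lemma PClass.opZ {n k : ℕ} (A : Matrix (Fin n) (Fin n) ℂ) {μ : ℝ}
    {p : (Fin (k + 2) → ℝ) → EuclideanSpace ℂ (Fin n)}
    (hp : p ∈ PClass (EuclideanSpace ℂ (Fin n)) 0 k μ) :
    opZ A p ∈ PClass (EuclideanSpace ℂ (Fin n)) 0 k μ := by
  obtain ⟨S, ξ, hS, hpS⟩ := hp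
  exact ⟨S, _, hS, fun z _ => opZ_eq_sum A hpS z⟩

/-! ### Linear stability -/

/-- If the spectrum of `T` lies in the open right half-plane, then `1 - h T` has spectral radius
less than one for small `h > 0`, so some power of it is small. -/
lemma exists_pow_norm_le {E : Type*} [NormedAddCommGroup E] [NormedSpace ℂ E]
    [FiniteDimensional ℂ E] (T : E →L[ℂ] E) (hT : ∀ z ∈ spectrum ℂ T, 0 < z.re) :
    ∃ h θ : ℝ, ∃ J : ℕ, 0 < h ∧ 0 < θ ∧ θ < 1 ∧ 0 < J ∧
      ‖(1 - (h : ℂ) • T) ^ J‖ ≤ θ ^ J := by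
  have : CompleteSpace E := FiniteDimensional.complete ℂ E
  rcases subsingleton_or_nontrivial E with hE | hE
  · exact ⟨1, 1 / 2, 1, by norm_num, by norm_num, by norm_num, by norm_num, by
      rw [Subsingleton.elim ((1 - ((1 : ℝ) : ℂ) • T) ^ 1) 0]; simp⟩
  -- by compactness of the spectrum one `h` serves all its points
  have hcomp : IsCompact (spectrum ℂ T) := spectrum.isCompact T
  obtain ⟨z₀, hz₀, hmin⟩ := hcomp.exists_isMinOn (spectrum.nonempty T)
    Complex.continuous_re.continuousOn
  obtain ⟨C, hC⟩ := hcomp.isBounded.exists_norm_le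
  set c := z₀.re with hc
  have hcpos : 0 < c := hT _ hz₀
  have hC0 : 0 ≤ C := (norm_nonneg _).trans (hC _ hz₀)
  -- `|1 - h w|² = 1 - 2 h Re w + h² |w|² ≤ 1 - 2 h c + h² C²`, so `h C² < c` suffices
  set h : ℝ := c / (C ^ 2 + 1) with hh
  have hpos : 0 < h := by positivity
  have hhC : h * C ^ 2 < c := by
    rw [hh, div_mul_eq_mul_div, div_lt_iff₀ (by positivity)]
    nlinarith
  have key : ∀ z ∈ spectrum ℂ (1 - (h : ℂ) • T), ‖z‖₊ < 1 := by
    intro z hz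
    rw [← map_one (algebraMap ℂ (E →L[ℂ] E)), ← spectrum.singleton_sub_eq,
      spectrum.smul_eq_smul _ _ (spectrum.nonempty T)] at hz
    obtain ⟨_, rfl, _, ⟨w, hw, rfl⟩, rfl⟩ := hz
    have h1 : c ≤ w.re := hmin hw
    have h2 : ‖w‖ ^ 2 ≤ C ^ 2 := pow_le_pow_left₀ (norm_nonneg _) (hC _ hw) 2
    have h3 : ‖1 - (h : ℂ) * w‖ ^ 2 = 1 - 2 * h * w.re + h ^ 2 * ‖w‖ ^ 2 := by
      rw [← Complex.normSq_eq_norm_sq, ← Complex.normSq_eq_norm_sq, Complex.normSq_apply,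
        Complex.normSq_apply]
      simp
      ring
    have h4 : ‖1 - (h : ℂ) * w‖ < 1 := by
      rw [← sq_lt_one_iff₀ (norm_nonneg _), h3]
      nlinarith [mul_le_mul_of_nonneg_left h1 hpos.le, mul_le_mul_of_nonneg_left h2 (sq_nonneg h),
        mul_lt_mul_of_pos_left hhC hpos]
    exact_mod_cast h4
  have hr := spectrum.spectralRadius_lt_of_forall_lt _ key
  obtain ⟨θ, hθ, hθ1⟩ := ENNReal.lt_iff_exists_nnreal_btwn.1 hr
  have hev := (spectrum.pow_nnnorm_pow_one_div_tendsto_nhds_spectralRadius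
    (1 - (h : ℂ) • T)).eventually (gt_mem_nhds hθ)
  obtain ⟨J, hJ, hJ0⟩ := (hev.and (eventually_gt_atTop 0)).exists
  refine ⟨h, θ, J, hpos, ?_, by exact_mod_cast hθ1, hJ0, ?_⟩
  · have : (0 : ENNReal) < θ := (zero_le).trans_lt hθ
    exact_mod_cast this
  · have h5 := ENNReal.rpow_le_rpow hJ.le (Nat.cast_nonneg J : (0 : ℝ) ≤ J)
    rw [← ENNReal.rpow_mul, one_div_mul_cancel (by exact_mod_cast hJ0.ne'), ENNReal.rpow_one,
      ENNReal.rpow_natCast] at h5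
    exact_mod_cast h5

/-- A Lyapunov norm for a linear map whose spectrum lies in the open right half-plane: with
`B = 1 - h T` and `‖B ^ J‖ ≤ θ ^ J`, take `P x = (θ⁻ʲ Bʲ x)_{j < J}`. Then `‖P B x‖ ≤ θ ‖P x‖`,
which gives the coercivity of `T` for the norm `‖P x‖`. -/
lemma exists_lyapunov {E : Type*} [NormedAddCommGroup E] [InnerProductSpace ℂ E]
    [FiniteDimensional ℂ E] (T : E →L[ℂ] E) (hT : ∀ z ∈ spectrum ℂ T, 0 < z.re) :
    ∃ (J : ℕ) (a : ℝ) (P : E →L[ℂ] PiLp 2 fun _ : Fin J => E),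
      0 < a ∧ (∀ x, ‖x‖ ≤ ‖P x‖) ∧ ∀ x, a * ‖P x‖ ^ 2 ≤ (inner ℂ (P x) (P (T x))).re := by
  obtain ⟨h, θ, J, hh, hθ, hθ1, hJ, hB⟩ := exists_pow_norm_le T hT
  set B := 1 - (h : ℂ) • T with hBdef
  let P : E →L[ℂ] PiLp 2 fun _ : Fin J => E :=
    (PiLp.continuousLinearEquiv 2 ℂ fun _ : Fin J => E).symm.toContinuousLinearMap ∘L
      ContinuousLinearMap.pi fun j : Fin J => ((θ⁻¹ ^ (j : ℕ) : ℝ) : ℂ) • B ^ (j : ℕ)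
  have hP : ∀ x, ‖P x‖ ^ 2 = ∑ j ∈ Finset.range J, (θ⁻¹ ^ j * ‖(B ^ j) x‖) ^ 2 := by
    intro x
    rw [PiLp.norm_sq_eq_of_L2, ← Fin.sum_univ_eq_sum_range
      (fun j => (θ⁻¹ ^ j * ‖(B ^ j) x‖) ^ 2)]
    refine Finset.sum_congr rfl fun j _ => ?_
    congr 1
    change ‖(((θ⁻¹ ^ (j : ℕ) : ℝ) : ℂ) • (B ^ (j : ℕ)) x)‖ = _
    rw [norm_smul, Complex.norm_real, Real.norm_of_nonneg (by positivity)]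
  have hPB : ∀ x, ‖P (B x)‖ ≤ θ * ‖P x‖ := by
    intro x
    refine le_of_sq_le_sq ?_ (by positivity)
    have e : ∀ j, (θ⁻¹ ^ j * ‖(B ^ j) (B x)‖) ^ 2 =
        θ ^ 2 * (θ⁻¹ ^ (j + 1) * ‖(B ^ (j + 1)) x‖) ^ 2 := by
      intro j
      rw [pow_succ B, mul_apply_eq_comp, pow_succ θ⁻¹]
      field_simp
    rw [mul_pow, hP, hP, Finset.sum_congr rfl fun j _ => e j, ← Finset.mul_sum]
    refine mul_le_mul_of_nonneg_left ?_ (by positivity)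
    have e1 := Finset.sum_range_succ (fun j => (θ⁻¹ ^ j * ‖(B ^ j) x‖) ^ 2) J
    have e2 := Finset.sum_range_succ' (fun j => (θ⁻¹ ^ j * ‖(B ^ j) x‖) ^ 2) J
    have e3 : θ⁻¹ ^ J * ‖(B ^ J) x‖ ≤ ‖x‖ := by
      have := ((B ^ J).le_opNorm x).trans (mul_le_mul_of_nonneg_right hB (norm_nonneg x))
      calc θ⁻¹ ^ J * ‖(B ^ J) x‖ ≤ θ⁻¹ ^ J * (θ ^ J * ‖x‖) := by gcongr
        _ = ‖x‖ := by rw [inv_pow]; field_simp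
    have e4 := pow_le_pow_left₀ (by positivity) e3 2
    simp only [pow_zero, one_apply_eq_self, one_mul] at e2
    linarith
  refine ⟨J, (1 - θ) / h, P, by have := sub_pos.2 hθ1; positivity, fun x => ?_, fun x => ?_⟩
  · refine le_of_sq_le_sq ?_ (norm_nonneg _)
    rw [hP]
    have := Finset.single_le_sum (f := fun j => (θ⁻¹ ^ j * ‖(B ^ j) x‖) ^ 2)
      (fun j _ => by positivity) (Finset.mem_range.2 hJ)
    simpa using this
  · have h1 : P (B x) = P x - (h : ℂ) • P (T x) := by
      simp [hBdef]
    have h2 : (inner ℂ (P x) (P (B x))).re = ‖P x‖ ^ 2 - h * (inner ℂ (P x) (P (T x))).re := by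
      rw [h1, inner_sub_right, inner_smul_right, Complex.sub_re, Complex.re_ofReal_mul]
      congr 1
      exact inner_self_eq_norm_sq (𝕜 := ℂ) _
    have h3 : (inner ℂ (P x) (P (B x))).re ≤ ‖P x‖ * ‖P (B x)‖ := re_inner_le_norm (𝕜 := ℂ) _ _
    have h4 := mul_le_mul_of_nonneg_left (hPB x) (norm_nonneg (P x))
    rw [div_mul_eq_mul_div, div_le_iff₀ hh]
    nlinarith

/-- The weight `t ^ σ` only perturbs the decay rate `a` by `σ / t`, so `t ^ σ V t` stays bounded. -/
lemma isBigO_rpow_of_deriv_le {V V' : ℝ → ℝ} {a C σ : ℝ} (ha : 0 < a) (hV : ∀ t, 0 ≤ V t)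
    (hd : ∀ᶠ t in atTop, HasDerivAt V (V' t) t)
    (hle : ∀ᶠ t in atTop, V' t ≤ -a * V t + C * t ^ (-σ)) :
    V =O[atTop] fun t => t ^ (-σ) := by
  obtain ⟨T, hT⟩ := eventually_atTop.1
    (hd.and (hle.and ((eventually_gt_atTop 0).and (eventually_ge_atTop (2 * σ / a)))))
  -- `u = t ^ σ V` satisfies `u' ≤ -(a / 2) u + C` for large `t`, so `g` is nonincreasing there
  set g : ℝ → ℝ := fun t => Real.exp (a / 2 * t) * (t ^ σ * V t - 2 * C / a) with hg
  have hgd : ∀ t, T ≤ t → HasDerivAt g (Real.exp (a / 2 * t) * (a / 2) * (t ^ σ * V t - 2 * C / a)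
      + Real.exp (a / 2 * t) * (σ * t ^ (σ - 1) * V t + t ^ σ * V' t)) t := by
    intro t ht
    obtain ⟨h1, -, h3, -⟩ := hT t ht
    have e1 : HasDerivAt (fun t : ℝ => Real.exp (a / 2 * t))
        (Real.exp (a / 2 * t) * (a / 2)) t := by
      simpa using ((hasDerivAt_id t).const_mul (a / 2)).exp
    exact e1.mul (((Real.hasDerivAt_rpow_const (Or.inl h3.ne')).mul h1).sub_const _)
  have hanti : AntitoneOn g (Set.Ici T) := by
    refine antitoneOn_of_deriv_nonpos (convex_Ici T)
      (fun t ht => (hgd t ht).continuousAt.continuousWithinAt)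
      (fun t ht => (hgd t (interior_subset ht)).differentiableAt.differentiableWithinAt)
      fun t ht => ?_
    have ht' : T ≤ t := interior_subset ht
    rw [(hgd t ht').deriv]
    obtain ⟨-, h2, h3, h4⟩ := hT t ht'
    have e1 : t ^ σ * t ^ (-σ) = 1 := by rw [← Real.rpow_add h3]; simp
    have e2 : σ * t ^ (σ - 1) ≤ a / 2 * t ^ σ := by
      rw [Real.rpow_sub_one h3.ne', mul_div_assoc', div_le_iff₀ h3]
      have : σ ≤ a / 2 * t := by
        rw [div_le_iff₀ ha] at h4
        linarith
      nlinarith [Real.rpow_pos_of_pos h3 σ]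
    have e3 := mul_le_mul_of_nonneg_right e2 (hV t)
    have e4 := mul_le_mul_of_nonneg_left h2 (Real.rpow_pos_of_pos h3 σ).le
    have e5 : a / 2 * (2 * C / a) = C := by field_simp
    have e6 : t ^ σ * (-a * V t + C * t ^ (-σ)) = -a * (t ^ σ * V t) + C := by
      linear_combination C * e1
    have e7 : a / 2 * (t ^ σ * V t - 2 * C / a) + (σ * t ^ (σ - 1) * V t + t ^ σ * V' t) ≤ 0 := by
      rw [mul_sub, e5]
      linarith
    have := mul_nonpos_of_nonneg_of_nonpos (Real.exp_pos (a / 2 * t)).le e7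
    linarith
  refine IsBigO.of_bound (|2 * C / a| + |T ^ σ * V T - 2 * C / a|) ?_
  filter_upwards [eventually_ge_atTop T] with t ht
  have h3 : 0 < t := (hT t ht).2.2.1
  have h5 := hanti Set.self_mem_Ici ht ht
  have h6 : t ^ σ * V t - 2 * C / a ≤ |T ^ σ * V T - 2 * C / a| := by
    have h7 : Real.exp (a / 2 * T) * (T ^ σ * V T - 2 * C / a) ≤
        Real.exp (a / 2 * t) * |T ^ σ * V T - 2 * C / a| :=
      (mul_le_mul_of_nonneg_left (le_abs_self _) (Real.exp_pos _).le).trans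
        (mul_le_mul_of_nonneg_right (Real.exp_le_exp.2 (by gcongr)) (abs_nonneg _))
    exact le_of_mul_le_mul_left (h5.trans h7) (Real.exp_pos _)
  have e1 : t ^ σ * t ^ (-σ) = 1 := by rw [← Real.rpow_add h3]; simp
  rw [Real.norm_of_nonneg (hV t), Real.norm_of_nonneg (Real.rpow_nonneg h3.le _)]
  have h8 := mul_le_mul_of_nonneg_right
    (show t ^ σ * V t ≤ |2 * C / a| + |T ^ σ * V T - 2 * C / a| by
      linarith [le_abs_self (2 * C / a)]) (Real.rpow_nonneg h3.le (-σ))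
  calc V t = t ^ σ * V t * t ^ (-σ) := by linear_combination -(V t) * e1
    _ ≤ _ := h8

/-- A solution of a stable linear equation with a perturbation `o(|w|) + O(t ^ (-ρ))` is itself
`O(t ^ (-ρ))`. -/
lemma isBigO_rpow_of_stable {n : ℕ} {T : EuclideanSpace ℂ (Fin n) →L[ℂ] EuclideanSpace ℂ (Fin n)}
    (hT : ∀ z ∈ spectrum ℂ T, 0 < z.re) {w R₁ R₂ : ℝ → EuclideanSpace ℂ (Fin n)} {ρ : ℝ}
    (hw : ∀ᶠ t in atTop, HasDerivAt w (-(T (w t)) + R₁ t + R₂ t) t)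
    (h₁ : R₁ =o[atTop] w) (h₂ : R₂ =O[atTop] fun t : ℝ => t ^ (-ρ)) :
    w =O[atTop] fun t : ℝ => t ^ (-ρ) := by
  obtain ⟨J, a, P, ha, hP, hPT⟩ := exists_lyapunov T hT
  obtain ⟨C, hC⟩ := h₂.bound
  have hη : 0 < a / (4 * (‖P‖ + 1)) := by positivity
  have hV : (fun t => ‖P (w t)‖ ^ 2) =O[atTop] fun t : ℝ => t ^ (-(2 * ρ)) := by
    refine isBigO_rpow_of_deriv_le (V' := fun t => 2 *
      (inner ℂ (P (w t)) (P (-(T (w t)) + R₁ t + R₂ t))).re) (C := 2 / a * (‖P‖ * C) ^ 2) ha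
      (fun t => by positivity) ?_ ?_
    · filter_upwards [hw] with t ht
      have h1 : HasDerivAt (fun t => P (w t)) (P (-(T (w t)) + R₁ t + R₂ t)) t :=
        (P.restrictScalars ℝ).hasFDerivAt.comp_hasDerivAt t ht
      have h2 := Complex.reCLM.hasFDerivAt.comp_hasDerivAt t (h1.inner ℂ h1)
      have h3 : (fun t => ‖P (w t)‖ ^ 2) =
          Complex.reCLM ∘ fun t => inner ℂ (P (w t)) (P (w t)) := by
        funext s
        exact (inner_self_eq_norm_sq (𝕜 := ℂ) (P (w s))).symm
      rw [h3]
      refine h2.congr_deriv ?_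
      have h4 : (inner ℂ (P (w t)) (P (-(T (w t)) + R₁ t + R₂ t))).re =
        (inner ℂ (P (-(T (w t)) + R₁ t + R₂ t)) (P (w t))).re := inner_re_symm (𝕜 := ℂ) _ _
      rw [Complex.reCLM_apply, Complex.add_re, ← h4, two_mul]
    · filter_upwards [h₁.bound hη, hC, eventually_gt_atTop 0] with t h1 h2 h3
      rw [Real.norm_of_nonneg (Real.rpow_nonneg h3.le _)] at h2
      set x := ‖P (w t)‖ with hx
      have e0 : 0 ≤ x := norm_nonneg _
      have e1 : (inner ℂ (P (w t)) (P (-(T (w t)) + R₁ t + R₂ t))).re ≤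
          -(a * x ^ 2) + x * ‖P (R₁ t)‖ + x * ‖P (R₂ t)‖ := by
        have i1 : (inner ℂ (P (w t)) (P (R₁ t))).re ≤ _ := re_inner_le_norm (𝕜 := ℂ) _ _
        have i2 : (inner ℂ (P (w t)) (P (R₂ t))).re ≤ _ := re_inner_le_norm (𝕜 := ℂ) _ _
        have i3 := hPT (w t)
        simp only [map_add, map_neg, inner_add_right, inner_neg_right, Complex.add_re,
          Complex.neg_re]
        linarith
      have e2 : ‖P (R₁ t)‖ ≤ a / 4 * x := by
        calc ‖P (R₁ t)‖ ≤ ‖P‖ * (a / (4 * (‖P‖ + 1)) * x) :=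
              (P.le_opNorm _).trans (by gcongr; exact h1.trans (by gcongr; exact hP _))
          _ = ‖P‖ / (‖P‖ + 1) * (a / 4 * x) := by field_simp
          _ ≤ 1 * (a / 4 * x) := by
              gcongr
              rw [div_le_one (by positivity)]
              linarith
          _ = _ := one_mul _
      have e3 : ‖P (R₂ t)‖ ≤ ‖P‖ * C * t ^ (-ρ) := by
        rw [mul_assoc]
        exact (P.le_opNorm _).trans (by gcongr)
      have e4 : t ^ (-(2 * ρ)) = (t ^ (-ρ)) ^ 2 := by
        rw [← Real.rpow_natCast, ← Real.rpow_mul h3.le]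
        congr 1
        push_cast
        ring
      have e5 : 2 * (x * (‖P‖ * C * t ^ (-ρ))) ≤
          a / 2 * x ^ 2 + 2 / a * (‖P‖ * C * t ^ (-ρ)) ^ 2 := by
        have : 0 ≤ (a * x - 2 * (‖P‖ * C * t ^ (-ρ))) ^ 2 / (2 * a) := by positivity
        have h : (a * x - 2 * (‖P‖ * C * t ^ (-ρ))) ^ 2 / (2 * a) =
            a / 2 * x ^ 2 + 2 / a * (‖P‖ * C * t ^ (-ρ)) ^ 2 - 2 * (x * (‖P‖ * C * t ^ (-ρ))) := by
          field_simp
          ring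
        linarith
      have e6 := mul_le_mul_of_nonneg_left e2 e0
      have e7 := mul_le_mul_of_nonneg_left e3 e0
      rw [e4]
      nlinarith
  have hsq : (fun t => ‖P (w t)‖ ^ 2) =O[atTop] fun t : ℝ => (t ^ (-ρ)) ^ 2 := by
    refine hV.congr' (EventuallyEq.refl _ _) ?_
    filter_upwards [eventually_gt_atTop 0] with t h3
    rw [← Real.rpow_natCast, ← Real.rpow_mul h3.le]
    congr 1
    push_cast
    ring
  have := IsBigO.of_pow (n := 2) two_ne_zero hsq
  exact (IsBigO.of_bound 1 (Eventually.of_forall fun t => by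
    rw [norm_norm, one_mul]; exact hP _)).trans this

/-- The eigenvalue hypothesis on a matrix in terms of the spectrum of the operator it induces. -/
lemma spectrum_re_pos {n : ℕ} {A : Matrix (Fin n) (Fin n) ℂ}
    (hA : ∀ Λ : ℂ, Module.End.HasEigenvalue (Matrix.toEuclideanLin A) Λ → 0 < Λ.re) :
    ∀ z ∈ spectrum ℂ (Module.End.toContinuousLinearMap _ (Matrix.toEuclideanLin A)), 0 < z.re := by
  intro z hz
  rw [AlgEquiv.spectrum_eq] at hz
  exact hA z (Module.End.hasEigenvalue_iff_mem_spectrum.2 hz)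

/-- `A + c I` is invertible for purely imaginary `c`. -/
lemma toEuclideanLin_add_smul_inv {n : ℕ} {A : Matrix (Fin n) (Fin n) ℂ}
    (hA : ∀ Λ : ℂ, Module.End.HasEigenvalue (Matrix.toEuclideanLin A) Λ → 0 < Λ.re)
    {c : ℂ} (hc : c.re = 0) (x : EuclideanSpace ℂ (Fin n)) :
    Matrix.toEuclideanLin A (Matrix.toEuclideanLin (A + c • (1 : Matrix (Fin n) (Fin n) ℂ))⁻¹ x) +
      c • Matrix.toEuclideanLin (A + c • (1 : Matrix (Fin n) (Fin n) ℂ))⁻¹ x = x := by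
  have hunit : IsUnit (A + c • (1 : Matrix (Fin n) (Fin n) ℂ)).det := by
    rw [isUnit_iff_ne_zero]
    intro h0
    obtain ⟨v, hv, hv0⟩ := Matrix.exists_mulVec_eq_zero_iff.2 h0
    have : Module.End.HasEigenvalue (Matrix.toEuclideanLin A) (-c) := by
      refine Module.End.hasEigenvalue_of_hasEigenvector (x := WithLp.toLp 2 v) ⟨?_, ?_⟩
      · rw [Module.End.mem_eigenspace_iff]
        rw [Matrix.add_mulVec, Matrix.smul_mulVec, Matrix.one_mulVec] at hv0
        rw [Matrix.toLpLin_toLp, Matrix.toLin'_apply, eq_neg_of_add_eq_zero_left hv0]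
        simp
      · simpa using hv
    have := hA _ this
    simp [hc] at this
  have h1 : Matrix.toEuclideanLin (A + c • (1 : Matrix (Fin n) (Fin n) ℂ))
      (Matrix.toEuclideanLin (A + c • (1 : Matrix (Fin n) (Fin n) ℂ))⁻¹ x) = x := by
    rw [Matrix.toLpLin_apply, Matrix.toLpLin_apply, Matrix.mulVec_mulVec,
      Matrix.mul_nonsing_inv _ hunit, Matrix.one_mulVec]
  have h2 : ∀ u, Matrix.toEuclideanLin (A + c • (1 : Matrix (Fin n) (Fin n) ℂ)) u =
      Matrix.toEuclideanLin A u + c • u := by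
    intro u
    simp [Matrix.toLpLin_apply]
  rw [← h2, h1]

/-! ### Growth and derivatives along the iterated logarithms -/

lemma tendsto_iterLog (j : ℕ) : Tendsto (iterLog j) atTop atTop := by
  induction j with
  | zero => exact tendsto_id
  | succ j ih => exact Real.tendsto_log_atTop.comp ih

lemma eventually_logVec_mem (k : ℕ) : ∀ᶠ t in atTop, logVec k t ∈ posOrthant k := by
  refine eventually_all.2 fun j => ?_
  refine Fin.cases ?_ (fun i => ?_) j
  · exact Eventually.of_forall fun t => Real.exp_pos t
  · exact (tendsto_iterLog i).eventually_gt_atTop 0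

/-- A property that holds for all large `t` holds in a neighbourhood of each large `t`. -/
lemma eventually_atTop_nhds {P : ℝ → Prop} (h : ∀ᶠ t in atTop, P t) :
    ∀ᶠ t in atTop, ∀ᶠ s in 𝓝 t, P s := by
  obtain ⟨T, hT⟩ := eventually_atTop.1 h
  filter_upwards [eventually_gt_atTop T] with t ht
  filter_upwards [Ioi_mem_nhds ht] with s hs
  exact hT s hs.le

lemma eventually_iterLog_succ_le_log (j : ℕ) :
    ∀ᶠ t in atTop, iterLog (j + 1) t ≤ Real.log t := by
  induction j with
  | zero => exact Eventually.of_forall fun t => le_rfl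
  | succ j ih =>
    filter_upwards [ih, (tendsto_iterLog (j + 1)).eventually_ge_atTop 0] with t h1 h2
    exact (Real.log_le_self h2).trans h1

lemma isBigO_iterLog_succ_rpow (j : ℕ) (b : ℝ) {ε : ℝ} (hε : 0 < ε) :
    (fun t => iterLog (j + 1) t ^ b) =O[atTop] fun t => t ^ ε := by
  refine IsBigO.trans ?_ (isLittleO_log_rpow_rpow_atTop |b| hε).isBigO
  refine IsBigO.of_bound 1 ?_
  filter_upwards [eventually_iterLog_succ_le_log j,
    (tendsto_iterLog (j + 1)).eventually_ge_atTop 1] with t h1 h2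
  have h0 : 0 ≤ iterLog (j + 1) t := zero_le_one.trans h2
  rw [Real.norm_of_nonneg (Real.rpow_nonneg h0 _),
    Real.norm_of_nonneg (Real.rpow_nonneg (h0.trans h1) _), one_mul]
  exact (Real.rpow_le_rpow_of_exponent_le h2 (le_abs_self b)).trans
    (Real.rpow_le_rpow h0 h1 (abs_nonneg b))

lemma isBigO_rpow_of_le {a b : ℝ} (h : a ≤ b) :
    (fun t : ℝ => t ^ a) =O[atTop] fun t : ℝ => t ^ b := by
  refine IsBigO.of_bound 1 ?_
  filter_upwards [eventually_ge_atTop 1] with t ht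
  have h0 : (0 : ℝ) ≤ t := zero_le_one.trans ht
  rw [Real.norm_of_nonneg (Real.rpow_nonneg h0 _), Real.norm_of_nonneg (Real.rpow_nonneg h0 _),
    one_mul]
  exact Real.rpow_le_rpow_of_exponent_le ht h

lemma isBigO_vecPow_logVec {k : ℕ} {μ r : ℝ} (hr : μ < r) {α : Fin (k + 2) → ℂ}
    (hα : α ∈ expSet 0 k μ) :
    (fun t => vecPow (logVec k t) α) =O[atTop] fun t : ℝ => t ^ r := by
  obtain ⟨h0, h1⟩ := mem_expSet_zero.1 hα
  -- each of the `k` logarithmic factors costs at most `t ^ ε`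
  set ε := (r - μ) / (k + 1) with hε
  have hεpos : 0 < ε := div_pos (sub_pos.2 hr) (by positivity)
  have e0 : (fun t : ℝ => ((Real.exp t : ℝ) : ℂ) ^ α 0) =O[atTop] fun _ : ℝ => (1 : ℝ) := by
    refine IsBigO.of_bound 1 (Eventually.of_forall fun t => ?_)
    rw [Complex.norm_cpow_eq_rpow_re_of_pos (Real.exp_pos t), h0]
    simp
  have e1 : (fun t : ℝ => (t : ℂ) ^ α 1) =O[atTop] fun t : ℝ => t ^ μ := by
    refine IsBigO.of_bound 1 ?_
    filter_upwards [eventually_gt_atTop 0] with t ht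
    rw [Complex.norm_cpow_eq_rpow_re_of_pos ht, h1, Real.norm_of_nonneg (Real.rpow_nonneg ht.le _),
      one_mul]
  have e2 : ∀ i ∈ (Finset.univ : Finset (Fin k)),
      (fun t : ℝ => ((iterLog (i + 1) t : ℝ) : ℂ) ^ α i.succ.succ) =O[atTop]
        fun t : ℝ => t ^ ε := by
    intro i _
    refine IsBigO.trans ?_ (isBigO_iterLog_succ_rpow i (α i.succ.succ).re hεpos)
    refine IsBigO.of_bound 1 ?_
    filter_upwards [(tendsto_iterLog (i + 1)).eventually_gt_atTop 0] with t ht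
    rw [Complex.norm_cpow_eq_rpow_re_of_pos ht, Real.norm_of_nonneg (Real.rpow_nonneg ht.le _),
      one_mul]
  have e3 := e0.mul (e1.mul (IsBigO.finsetProd e2))
  refine (e3.congr_left fun t => ?_).trans ?_
  · rw [vecPow, Fin.prod_univ_succ, Fin.prod_univ_succ]
    rfl
  · refine IsBigO.congr' (isBigO_rpow_of_le (a := μ + ε * k) (b := r) ?_) ?_ (EventuallyEq.refl _ _)
    · have : ε * (k + 1) = r - μ := by rw [hε]; field_simp
      linarith
    · filter_upwards [eventually_gt_atTop 0] with t ht
      rw [Real.rpow_add ht, Real.rpow_mul ht.le]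
      simp

lemma PClass.isBigO {X : Type*} [NormedAddCommGroup X] [NormedSpace ℂ X] {k : ℕ} {μ r : ℝ}
    {p : (Fin (k + 2) → ℝ) → X} (hp : p ∈ PClass X 0 k μ) (hr : μ < r) :
    (fun t => p (logVec k t)) =O[atTop] fun t : ℝ => t ^ r := by
  obtain ⟨S, ξ, hS, hpS⟩ := hp
  have : (fun t => ∑ α ∈ S, vecPow (logVec k t) α • ξ α) =O[atTop] fun t : ℝ => t ^ r := by
    refine IsBigO.fun_sum fun α hα => ?_
    have := (isBigO_vecPow_logVec hr (hS α hα)).smul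
      (isBigO_refl (fun _ : ℝ => ξ α) atTop)
    refine this.trans (IsBigO.of_bound ‖ξ α‖ (Eventually.of_forall fun t => ?_))
    rw [norm_smul, mul_comm]
  refine this.congr' ?_ (EventuallyEq.refl _ _)
  filter_upwards [eventually_logVec_mem k] with t ht
  exact (hpS _ ht).symm

lemma hasDerivAt_iterLog {j : ℕ} {t : ℝ} (h : ∀ i < j, 0 < iterLog i t) :
    HasDerivAt (iterLog j) (∏ i ∈ Finset.range j, (iterLog i t)⁻¹) t := by
  induction j with
  | zero =>
    rw [Finset.prod_range_zero]
    exact hasDerivAt_id t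
  | succ j ih =>
    rw [Finset.prod_range_succ]
    exact (ih fun i hi => h i (hi.trans j.lt_succ_self)).log (h j j.lt_succ_self).ne'

lemma vecPow_logVec_eq_exp {k : ℕ} {t : ℝ} (ht : logVec k t ∈ posOrthant k)
    (α : Fin (k + 2) → ℂ) :
    vecPow (logVec k t) α =
      Complex.exp (t * α 0 + ∑ j : Fin (k + 1), (iterLog (j + 1) t : ℂ) * α j.succ) := by
  rw [vecPow, Fin.prod_univ_succ, Complex.exp_add, Complex.exp_sum]
  congr 1
  · change ((Real.exp t : ℝ) : ℂ) ^ α 0 = _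
    rw [Complex.cpow_def_of_ne_zero (by exact_mod_cast (Real.exp_pos _).ne'),
      ← Complex.ofReal_log (Real.exp_pos _).le, Real.log_exp]
  · refine Finset.prod_congr rfl fun j _ => ?_
    have hj : 0 < iterLog j t := ht j.succ
    change ((iterLog j t : ℝ) : ℂ) ^ α j.succ = _
    rw [Complex.cpow_def_of_ne_zero (by exact_mod_cast hj.ne'), ← Complex.ofReal_log hj.le]
    rfl

/-- Since `L_{-1}' / L_{-1} = 1` and `L_j' / L_j = 1 / (L_0 ⋯ L_j)` for `j ≥ 0`, the derivative of
a monomial along `logVec` is again a combination of monomials. -/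
lemma hasDerivAt_vecPow_logVec (k : ℕ) (α : Fin (k + 2) → ℂ) :
    ∀ᶠ t in atTop, HasDerivAt (fun t => vecPow (logVec k t) α)
      (α 0 * vecPow (logVec k t) α +
        ∑ j : Fin (k + 1), α j.succ * vecPow (logVec k t) (invExp k j + α)) t := by
  filter_upwards [eventually_atTop_nhds (eventually_logVec_mem k)] with t ht
  have ht0 := ht.self_of_nhds
  have h1 : ∀ j : Fin (k + 1), HasDerivAt (fun t => ((iterLog (j + 1) t : ℝ) : ℂ) * α j.succ)
      (vecPow (logVec k t) (invExp k j) * α j.succ) t := by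
    intro j
    rw [vecPow_invExp]
    refine (HasDerivAt.ofReal_comp ?_).mul_const _
    have h := hasDerivAt_iterLog (j := j + 1) (t := t)
      fun i hi => ht0 (Fin.succ ⟨i, by omega⟩)
    refine h.congr_deriv ?_
    rw [Nat.range_succ_eq_Iic, ← Fin.map_valEmbedding_Iic, Finset.prod_map]
    rfl
  have h2 : HasDerivAt (fun t : ℝ => (t : ℂ) * α 0 +
      ∑ j : Fin (k + 1), (iterLog (j + 1) t : ℂ) * α j.succ)
      (1 * α 0 + ∑ j : Fin (k + 1), vecPow (logVec k t) (invExp k j) * α j.succ) t :=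
    (Complex.ofRealCLM.hasDerivAt.mul_const _).add (HasDerivAt.fun_sum fun j _ => h1 j)
  refine (h2.cexp.congr_of_eventuallyEq (ht.mono fun s hs => vecPow_logVec_eq_exp hs α)).congr_deriv
    ?_
  rw [← vecPow_logVec_eq_exp ht0, mul_add, Finset.mul_sum]
  congr 1
  · ring
  · refine Finset.sum_congr rfl fun j _ => ?_
    rw [vecPow_add ht0]
    ring

/-- If `q = 𝒵_A g`, then `q ∘ logVec` solves the linear equation with right-hand side `g + ℛ q`:
the part `ℳ_{-1} q` of its derivative combines with `A q` to `g`. -/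
lemma hasDerivAt_opZ_logVec {n k : ℕ} {A : Matrix (Fin n) (Fin n) ℂ}
    (hA : ∀ Λ : ℂ, Module.End.HasEigenvalue (Matrix.toEuclideanLin A) Λ → 0 < Λ.re) {μ : ℝ}
    {g q : (Fin (k + 2) → ℝ) → EuclideanSpace ℂ (Fin n)}
    (hg : g ∈ PClass (EuclideanSpace ℂ (Fin n)) 0 k μ)
    (hq : ∀ z ∈ posOrthant k, q z = opZ A g z) :
    ∀ᶠ t in atTop, HasDerivAt (fun t => q (logVec k t))
      (-(Matrix.toEuclideanLin A (q (logVec k t))) + g (logVec k t) + opR q (logVec k t)) t := by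
  obtain ⟨S, ξ, hS, hgS⟩ := hg
  set η := fun α : Fin (k + 2) → ℂ =>
    Matrix.toEuclideanLin (A + α 0 • (1 : Matrix (Fin n) (Fin n) ℂ))⁻¹ (ξ α) with hη
  have hqS : ∀ z ∈ posOrthant k, q z = ∑ α ∈ S, vecPow z α • η α := fun z hz =>
    (hq z hz).trans (opZ_eq_sum A hgS z)
  have hS' : ∀ᶠ t in atTop, ∀ α ∈ S, HasDerivAt (fun t => vecPow (logVec k t) α)
      (α 0 * vecPow (logVec k t) α +
        ∑ j : Fin (k + 1), α j.succ * vecPow (logVec k t) (invExp k j + α)) t :=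
    (eventually_all_finset S).2 fun α _ => hasDerivAt_vecPow_logVec k α
  filter_upwards [eventually_atTop_nhds (eventually_logVec_mem k), hS'] with t ht hd
  have ht0 := ht.self_of_nhds
  have h1 := HasDerivAt.fun_sum fun α hα => (hd α hα).smul_const (η α)
  refine (h1.congr_of_eventuallyEq (ht.mono fun s hs => hqS _ hs)).congr_deriv ?_
  rw [hqS _ ht0, hgS _ ht0, opR_eq_sum hqS ht0, map_sum, ← Finset.sum_neg_distrib,
    ← Finset.sum_add_distrib, ← Finset.sum_add_distrib]
  refine Finset.sum_congr rfl fun α hα => ?_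
  rw [add_smul, Finset.sum_smul, map_smul]
  congr 1
  · have h2 := toEuclideanLin_add_smul_inv hA (mem_expSet_zero.1 (hS α hα)).1 (ξ α)
    rw [← eq_sub_iff_add_eq'] at h2
    rw [mul_comm, mul_smul, show α 0 • η α = ξ α - Matrix.toEuclideanLin A (η α) from h2, smul_sub]
    abel
  · refine Finset.sum_congr rfl fun j _ => ?_
    rw [mul_comm, mul_smul]

/-! ### The nonlinearity near the origin -/

lemma continuous_multilinear {n m : ℕ}
    (f : MultilinearMap ℂ (fun _ : Fin m => EuclideanSpace ℂ (Fin n))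
      (EuclideanSpace ℂ (Fin n))) : Continuous f := by
  have h : ∀ v : Fin m → EuclideanSpace ℂ (Fin n), f v =
      ∑ r : Fin m → Fin n, (∏ i, v i (r i)) • f fun i => EuclideanSpace.single (r i) 1 := by
    intro v
    have hv : v = fun i => ∑ j, v i j • (EuclideanSpace.single j 1 : EuclideanSpace ℂ (Fin n)) := by
      funext i
      ext l
      simp [Pi.single_apply]
    conv_lhs => rw [hv]
    rw [f.map_sum]
    exact Finset.sum_congr rfl fun r _ => f.map_smul_univ _ _
  rw [show (f : (Fin m → EuclideanSpace ℂ (Fin n)) → _) = _ from funext h]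
  fun_prop

/-- A homogeneous map of degree at least two has arbitrarily small Lipschitz constants near the
origin. -/
lemma isLittleO_multilinear_diag_sub {n m : ℕ} (hm : 2 ≤ m)
    (f : MultilinearMap ℂ (fun _ : Fin m => EuclideanSpace ℂ (Fin n)) (EuclideanSpace ℂ (Fin n)))
    {y s : ℝ → EuclideanSpace ℂ (Fin n)} (hy : Tendsto y atTop (𝓝 0))
    (hs : Tendsto s atTop (𝓝 0)) :
    (fun t => f (fun _ => y t) - f fun _ => s t) =o[atTop] fun t => y t - s t := by
  let F : ContinuousMultilinearMap ℂ (fun _ : Fin m => EuclideanSpace ℂ (Fin n))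
    (EuclideanSpace ℂ (Fin n)) := ⟨f, continuous_multilinear f⟩
  set c : ℝ → ℝ := fun t => ‖F‖ * m * max ‖y t‖ ‖s t‖ ^ (m - 1) with hc
  have hc0 : Tendsto c atTop (𝓝 0) := by
    have h1 := ((hy.norm.max hs.norm).pow (m - 1)).const_mul (‖F‖ * m)
    simpa [show m - 1 ≠ 0 by omega] using h1
  have h2 : (fun t => c t * ‖y t - s t‖) =o[atTop] fun t => (1 : ℝ) * ‖y t - s t‖ :=
    ((isLittleO_one_iff ℝ).2 hc0).mul_isBigO (isBigO_refl _ _)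
  simp only [one_mul] at h2
  refine IsBigO.trans_isLittleO (IsBigO.of_bound 1 (Eventually.of_forall fun t => ?_))
    h2.of_norm_right
  have h3 := F.norm_image_sub_le (fun _ => y t) (fun _ => s t)
  have h4 : ‖(fun _ => y t : Fin m → EuclideanSpace ℂ (Fin n)) - fun _ => s t‖ ≤ ‖y t - s t‖ :=
    pi_norm_const_le _
  rw [Real.norm_of_nonneg (by positivity), one_mul]
  refine h3.trans ?_
  rw [Fintype.card_fin]
  change _ ≤ ‖F‖ * m * max ‖y t‖ ‖s t‖ ^ (m - 1) * ‖y t - s t‖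
  have h5 : ‖(fun _ => y t : Fin m → EuclideanSpace ℂ (Fin n))‖ ≤ ‖y t‖ := pi_norm_const_le _
  have h6 : ‖(fun _ => s t : Fin m → EuclideanSpace ℂ (Fin n))‖ ≤ ‖s t‖ := pi_norm_const_le _
  gcongr

/-- The nonlinearity at the solution `y` compared with its Taylor polynomial at an approximation
`s`. If `s` dominates `y - s`, the Taylor remainder is a high power of `s`, hence of `t⁻¹`;
otherwise it is superlinear in `y - s`. -/
lemma exists_nonlinearity_split {n : ℕ} {G : EuclideanSpace ℂ (Fin n) → EuclideanSpace ℂ (Fin n)}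
    {𝒢 : ∀ m : ℕ, MultilinearMap ℂ (fun _ : Fin m => EuclideanSpace ℂ (Fin n))
      (EuclideanSpace ℂ (Fin n))} {M : ℕ} (hM : 2 ≤ M) {δ : ℝ} (hδ : 0 < δ)
    (hG : (fun x => G x - ∑ m ∈ Finset.Icc 2 M, 𝒢 m fun _ => x) =O[𝓝 0]
      fun x => ‖x‖ ^ ((M : ℝ) + δ))
    {y s : ℝ → EuclideanSpace ℂ (Fin n)} (hy : Tendsto y atTop (𝓝 0))
    (hs : Tendsto s atTop (𝓝 0)) {κ ρ : ℝ} (hsO : s =O[atTop] fun t : ℝ => t ^ (-κ))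
    (hρ : ρ ≤ M * κ) :
    ∃ R₁ R₂ : ℝ → EuclideanSpace ℂ (Fin n),
      (∀ t, G (y t) - ∑ m ∈ Finset.Icc 2 M, 𝒢 m (fun _ => s t) = R₁ t + R₂ t) ∧
      R₁ =o[atTop] (fun t => y t - s t) ∧ R₂ =O[atTop] fun t : ℝ => t ^ (-ρ) := by
  classical
  set r : ℝ → EuclideanSpace ℂ (Fin n) :=
    fun t => G (y t) - ∑ m ∈ Finset.Icc 2 M, 𝒢 m (fun _ => y t) with hr
  have hrO : r =O[atTop] fun t => ‖y t‖ ^ M := by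
    refine (hG.comp_tendsto hy).trans (IsBigO.of_bound 1 ?_)
    filter_upwards [hy.norm.eventually
      (gt_mem_nhds (by simp : ‖(0 : EuclideanSpace ℂ (Fin n))‖ < 1))] with t ht
    rw [one_mul, norm_pow, norm_norm, Function.comp_apply, Real.norm_of_nonneg (by positivity)]
    rcases (norm_nonneg (y t)).eq_or_lt with h0 | h0
    · rw [← h0, Real.zero_rpow (by positivity), zero_pow (by omega)]
    · rw [← Real.rpow_natCast]
      exact Real.rpow_le_rpow_of_exponent_ge h0 ht.le (by linarith)
  obtain ⟨C, hC⟩ := hrO.bound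
  simp only [norm_pow, norm_norm] at hC
  have hC' : ∀ᶠ t in atTop, ‖r t‖ ≤ |C| * ‖y t‖ ^ M :=
    hC.mono fun t ht => ht.trans (mul_le_mul_of_nonneg_right (le_abs_self C) (by positivity))
  have htri : ∀ t, ‖y t‖ ≤ ‖y t - s t‖ + ‖s t‖ := fun t => by
    simpa using norm_add_le (y t - s t) (s t)
  have hw : Tendsto (fun t => y t - s t) atTop (𝓝 0) := by simpa using hy.sub hs
  refine ⟨fun t => (if ‖s t‖ ≤ ‖y t - s t‖ then r t else 0) +
      ∑ m ∈ Finset.Icc 2 M, (𝒢 m (fun _ => y t) - 𝒢 m fun _ => s t),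
    fun t => if ‖s t‖ ≤ ‖y t - s t‖ then 0 else r t, fun t => ?_, ?_, ?_⟩
  · simp only [Finset.sum_sub_distrib]
    split_ifs <;> simp [hr]
  · refine IsLittleO.add ?_ (IsLittleO.fun_sum fun m hm =>
      isLittleO_multilinear_diag_sub (Finset.mem_Icc.1 hm).1 (𝒢 m) hy hs)
    have h1 : (fun t => ‖y t - s t‖ ^ M) =o[atTop] fun t => ‖y t - s t‖ ^ 1 :=
      (isLittleO_pow_pow (by omega)).comp_tendsto (by simpa using hw.norm)
    simp only [pow_one] at h1
    refine IsBigO.trans_isLittleO (IsBigO.of_bound (|C| * 2 ^ M) ?_) h1.of_norm_right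
    filter_upwards [hC'] with t ht
    rw [norm_pow, norm_norm]
    split_ifs with h
    · refine ht.trans ?_
      rw [mul_assoc, ← mul_pow]
      gcongr
      linarith [htri t]
    · rw [norm_zero]
      positivity
  · have h1 : (fun t => ‖s t‖ ^ M) =O[atTop] fun t : ℝ => t ^ (-ρ) := by
      refine (hsO.norm_left.pow M).trans ?_
      refine IsBigO.congr' (isBigO_rpow_of_le (a := -κ * M) (b := -ρ) (by linarith)) ?_
        (EventuallyEq.refl _ _)
      filter_upwards [eventually_gt_atTop 0] with t ht
      rw [Real.rpow_mul ht.le, Real.rpow_natCast]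
    refine IsBigO.trans (IsBigO.of_bound (|C| * 2 ^ M) ?_) h1
    filter_upwards [hC'] with t ht
    rw [norm_pow, norm_norm]
    split_ifs with h
    · rw [norm_zero]
      positivity
    · refine ht.trans ?_
      rw [mul_assoc, ← mul_pow]
      gcongr
      linarith [htri t]

/-! ### Polarization -/

/-- Every homogeneous polynomial map is the diagonal of a multilinear map: a monomial of degree
`m` is a product of `m` coordinates, which may be evaluated at `m` different vectors. -/
lemma IsHomogPolyMap.exists_multilinear {n m : ℕ}
    {Q : EuclideanSpace ℂ (Fin n) → EuclideanSpace ℂ (Fin n)} (hQ : IsHomogPolyMap m Q) :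
    ∃ f : MultilinearMap ℂ (fun _ : Fin m => EuclideanSpace ℂ (Fin n)) (EuclideanSpace ℂ (Fin n)),
      ∀ x, Q x = f fun _ => x := by
  choose F hF hQF using hQ
  have hmon : ∀ i, ∀ d ∈ (F i).support, ∃ σ : Fin m → Fin n,
      ∀ x : Fin n → ℂ, d.prod (fun j e => x j ^ e) = ∏ l, x (σ l) := by
    intro i d hd
    have hcard : (Finsupp.toMultiset d).toList.length = m := by
      rw [Multiset.length_toList, Finsupp.card_toMultiset]
      have := hF i (MvPolynomial.mem_support_iff.1 hd)
      rw [Finsupp.weight_apply] at this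
      simpa [Finsupp.sum] using this
    refine ⟨fun l => (Finsupp.toMultiset d).toList.get (Fin.cast hcard.symm l), fun x => ?_⟩
    have h1 : (Multiset.map x (Finsupp.toMultiset d)).prod = d.prod fun j e => x j ^ e :=
      by rw [Finsupp.toMultiset_map, Finsupp.prod_toMultiset, Finsupp.prod_mapDomain_index
        (by simp) (by intros; rw [pow_add])]
    have h2 : ((Finsupp.toMultiset d).toList.map x).prod =
        (Multiset.map x (Finsupp.toMultiset d)).prod := by
      rw [← Multiset.prod_coe, ← Multiset.map_coe, Multiset.coe_toList]
    rw [← h1, ← h2, ← Fin.prod_univ_fun_getElem, ← (finCongr hcard.symm).prod_comp]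
    rfl
  choose! σ hσ using hmon
  let g : ∀ i : Fin n, MultilinearMap ℂ (fun _ : Fin m => EuclideanSpace ℂ (Fin n)) ℂ := fun i =>
    ∑ d ∈ (F i).support, (F i).coeff d • (MultilinearMap.mkPiAlgebra ℂ (Fin m) ℂ).compLinearMap
      fun l => (EuclideanSpace.proj (σ i d l) : EuclideanSpace ℂ (Fin n) →L[ℂ] ℂ).toLinearMap
  refine ⟨∑ i, (LinearMap.toSpanSingleton ℂ (EuclideanSpace ℂ (Fin n))
    (EuclideanSpace.single i 1)).compMultilinearMap (g i), fun x => ?_⟩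
  ext i
  rw [hQF, MvPolynomial.eval_eq']
  simp [g, Pi.single_apply]
  refine Finset.sum_congr rfl fun d hd => ?_
  rw [← hσ i d hd (fun j => x j), Finsupp.prod_fintype _ _ (by simp)]

/-! ### The recursion -/

section recursion

variable {n : ℕ} {ν : ℕ → ℕ} {μ : ℕ → ℝ}
  {𝒢 : ∀ m : ℕ, MultilinearMap ℂ (fun _ : Fin m => EuclideanSpace ℂ (Fin n))
    (EuclideanSpace ℂ (Fin n))}
  {p q : ∀ k : ℕ, (Fin (ν k + 2) → ℝ) → EuclideanSpace ℂ (Fin n)}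

lemma tupleSet_lt (hpos : ∀ k, 0 < μ k) (hmono : StrictMono μ) {k : ℕ}
    {x : Σ m : ℕ, Fin m → ℕ} (hx : x ∈ tupleSet μ k) (i : Fin x.1) : x.2 i < k := by
  obtain ⟨h2, hs⟩ := hx
  have : Nontrivial (Fin x.1) := Fin.nontrivial_iff_two_le.2 h2
  obtain ⟨j, hj⟩ := exists_ne i
  rw [← hmono.lt_iff_lt, ← hs]
  exact Finset.single_lt_sum (f := fun i => μ (x.2 i)) hj (Finset.mem_univ i) (Finset.mem_univ j)
    (hpos _) fun _ _ _ => (hpos _).le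

lemma tupleSet_length_mul_le (hmono : StrictMono μ) {k : ℕ}
    {x : Σ m : ℕ, Fin m → ℕ} (hx : x ∈ tupleSet μ k) : (x.1 : ℝ) * μ 0 ≤ μ k := by
  rw [← hx.2]
  calc (x.1 : ℝ) * μ 0 = ∑ _i : Fin x.1, μ 0 := by simp
    _ ≤ _ := Finset.sum_le_sum fun i _ => hmono.monotone (Nat.zero_le _)

lemma nonlinTerm_congr (hpos : ∀ k, 0 < μ k) (hmono : StrictMono μ) {k : ℕ}
    {q' : ∀ k : ℕ, (Fin (ν k + 2) → ℝ) → EuclideanSpace ℂ (Fin n)}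
    (h : ∀ j < k, q j = q' j) : nonlinTerm ν μ 𝒢 q k = nonlinTerm ν μ 𝒢 q' k := by
  funext z
  refine finsum_mem_congr rfl fun x hx => ?_
  congr 1
  funext i
  rw [h _ (tupleSet_lt hpos hmono hx i)]

lemma chiTerm_congr {k : ℕ} {q' : ∀ k : ℕ, (Fin (ν k + 2) → ℝ) → EuclideanSpace ℂ (Fin n)}
    (h : ∀ j < k, q j = q' j) : chiTerm ν μ q k = chiTerm ν μ q' k := by
  unfold chiTerm
  split_ifs with hk
  · rw [h _ hk.choose_spec.1]
  · rfl

/-- The right-hand side of the recursion for `q k` involves only the `q j` with `j < k`, so the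
recursion has a solution. -/
lemma exists_satisfiesRecursion (A : Matrix (Fin n) (Fin n) ℂ) (hpos : ∀ k, 0 < μ k)
    (hmono : StrictMono μ) (p : ∀ k : ℕ, (Fin (ν k + 2) → ℝ) → EuclideanSpace ℂ (Fin n)) :
    ∃ q, SatisfiesRecursion A ν μ 𝒢 p q := by
  classical
  let F : ∀ k, (∀ j, j < k → (Fin (ν j + 2) → ℝ) → EuclideanSpace ℂ (Fin n)) →
      (Fin (ν k + 2) → ℝ) → EuclideanSpace ℂ (Fin n) := fun k ih =>
    opZ A fun w => nonlinTerm ν μ 𝒢 (fun j => if h : j < k then ih j h else 0) k w + p k w -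
      chiTerm ν μ (fun j => if h : j < k then ih j h else 0) k w
  refine ⟨Nat.lt_wfRel.wf.fix F, fun k z _ => ?_⟩
  rw [WellFounded.fix_eq]
  set q := Nat.lt_wfRel.wf.fix F with hq
  have h : ∀ j < k, (if _ : j < k then q j else 0) = q j := fun j hj => by simp [hj]
  change opZ A (fun w => nonlinTerm ν μ 𝒢 (fun j => if _ : j < k then q j else 0) k w + p k w -
      chiTerm ν μ (fun j => if _ : j < k then q j else 0) k w) z = _
  rw [nonlinTerm_congr hpos hmono h, chiTerm_congr h]

lemma nonlinTerm_mem (hpos : ∀ k, 0 < μ k) (hmono : StrictMono μ) (hν : Monotone ν) {k : ℕ}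
    (hq : ∀ j < k, q j ∈ PClass (EuclideanSpace ℂ (Fin n)) 0 (ν j) (-μ j)) :
    nonlinTerm ν μ 𝒢 q k ∈ PClass (EuclideanSpace ℂ (Fin n)) 0 (ν k) (-μ k) := by
  have h : nonlinTerm ν μ 𝒢 q k = ∑ x ∈ (tupleSet_finite hpos hmono k).toFinset,
      fun z => 𝒢 x.1 fun i => liftVar (ν k) (q (x.2 i)) z := by
    funext z
    rw [nonlinTerm, finsum_mem_eq_finite_toFinset_sum _ (tupleSet_finite hpos hmono k),
      Finset.sum_apply]
  rw [h]
  refine (PSubmodule _ 0 (ν k) (-μ k)).sum_mem fun x hx => ?_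
  rw [Set.Finite.mem_toFinset] at hx
  refine PClass.of_eq ?_ (PClass.multilinear (𝒢 x.1) (μ := fun i => -μ (x.2 i)) fun i =>
    PClass.liftVar (hν (tupleSet_lt hpos hmono hx i).le) (hq _ (tupleSet_lt hpos hmono hx i)))
  rw [Finset.sum_neg_distrib, hx.2]

lemma chiTerm_mem (hν : Monotone ν) {k : ℕ}
    (hq : ∀ j < k, q j ∈ PClass (EuclideanSpace ℂ (Fin n)) 0 (ν j) (-μ j)) :
    chiTerm ν μ q k ∈ PClass (EuclideanSpace ℂ (Fin n)) 0 (ν k) (-μ k) := by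
  unfold chiTerm
  split_ifs with hk
  · have h := hk.choose_spec
    refine PClass.liftVar (hν h.1.le) (PClass.of_eq ?_ (PClass.opR (hq _ h.1)))
    linarith [h.2]
  · exact (PSubmodule _ 0 (ν k) (-μ k)).zero_mem

lemma recursion_rhs_mem (hpos : ∀ k, 0 < μ k) (hmono : StrictMono μ) (hν : Monotone ν)
    (hp : ∀ k, p k ∈ PClass (EuclideanSpace ℂ (Fin n)) 0 (ν k) (-μ k)) {k : ℕ}
    (hq : ∀ j < k, q j ∈ PClass (EuclideanSpace ℂ (Fin n)) 0 (ν j) (-μ j)) :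
    (fun w => nonlinTerm ν μ 𝒢 q k w + p k w - chiTerm ν μ q k w) ∈
      PClass (EuclideanSpace ℂ (Fin n)) 0 (ν k) (-μ k) :=
  Submodule.sub_mem (PSubmodule (EuclideanSpace ℂ (Fin n)) 0 (ν k) (-μ k))
    (x := nonlinTerm ν μ 𝒢 q k + p k)
    (Submodule.add_mem _ (nonlinTerm_mem hpos hmono hν hq) (hp k)) (chiTerm_mem hν hq)

lemma SatisfiesRecursion.mem_PClass {A : Matrix (Fin n) (Fin n) ℂ} (hpos : ∀ k, 0 < μ k)
    (hmono : StrictMono μ) (hν : Monotone ν)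
    (hp : ∀ k, p k ∈ PClass (EuclideanSpace ℂ (Fin n)) 0 (ν k) (-μ k))
    (hq : SatisfiesRecursion A ν μ 𝒢 p q) (k : ℕ) :
    q k ∈ PClass (EuclideanSpace ℂ (Fin n)) 0 (ν k) (-μ k) := by
  induction k using Nat.strong_induction_on with
  | _ k ih => exact PClass.congr (PClass.opZ A (recursion_rhs_mem hpos hmono hν hp ih)) (hq k)

/-! ### The truncated expansion as an approximate solution -/

lemma chiTerm_logVec (hmono : StrictMono μ) (hν : Monotone ν) {N k : ℕ} (hk : k ≤ N) (t : ℝ) :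
    chiTerm ν μ q k (logVec (ν k) t) = ∑ l ∈ Finset.range (N + 1),
      if μ l + 1 = μ k then opR (q l) (logVec (ν l) t) else 0 := by
  unfold chiTerm
  split_ifs with h
  · obtain ⟨h1, h2⟩ := h.choose_spec
    rw [liftVar_logVec (hν h1.le), Finset.sum_eq_single h.choose]
    · rw [if_pos h2]
    · intro l _ hl
      refine if_neg fun h3 => hl (hmono.injective ?_)
      linarith
    · intro h3
      exact absurd (Finset.mem_range.2 (by omega)) h3
  · refine (Finset.sum_eq_zero fun l _ => if_neg fun h3 => h ⟨l, ?_, h3⟩).symm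
    rw [← hmono.lt_iff_lt]
    linarith

/-- All tuples of length `2 ≤ m ≤ M` with entries at most `N`. -/
def boundedTuples (M N : ℕ) : Finset (Σ m : ℕ, Fin m → ℕ) :=
  (Finset.Icc 2 M).sigma fun m => Fintype.piFinset fun _ : Fin m => Finset.range (N + 1)

lemma nonlinTerm_logVec (hpos : ∀ k, 0 < μ k) (hmono : StrictMono μ) (hν : Monotone ν)
    {M N k : ℕ} (hk : k ≤ N) (hM : μ N ≤ M * μ 0) (t : ℝ) :
    nonlinTerm ν μ 𝒢 q k (logVec (ν k) t) = ∑ x ∈ boundedTuples M N,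
      if ∑ i, μ (x.2 i) = μ k then 𝒢 x.1 fun i => q (x.2 i) (logVec (ν (x.2 i)) t) else 0 := by
  classical
  have hset : (tupleSet_finite hpos hmono k).toFinset =
      (boundedTuples M N).filter fun x => ∑ i, μ (x.2 i) = μ k := by
    ext x
    simp only [Set.Finite.mem_toFinset, Finset.mem_filter, boundedTuples, Finset.mem_sigma,
      Finset.mem_Icc, Fintype.mem_piFinset, Finset.mem_range]
    constructor
    · intro hx
      refine ⟨⟨⟨hx.1, ?_⟩, fun i => ?_⟩, hx.2⟩
      · have h1 := (tupleSet_length_mul_le hmono hx).trans ((hmono.monotone hk).trans hM)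
        exact_mod_cast le_of_mul_le_mul_right h1 (hpos 0)
      · have := tupleSet_lt hpos hmono hx i
        omega
    · rintro ⟨⟨⟨h1, -⟩, -⟩, h2⟩
      exact ⟨h1, h2⟩
  rw [nonlinTerm, finsum_mem_eq_finite_toFinset_sum _ (tupleSet_finite hpos hmono k),
    ← Finset.sum_filter, ← hset]
  refine Finset.sum_congr rfl fun x hx => ?_
  rw [Set.Finite.mem_toFinset] at hx
  congr 1
  funext i
  exact liftVar_logVec (hν (tupleSet_lt hpos hmono hx i).le) _ _

lemma multilinear_diag_sum (M N : ℕ) (Y : ℕ → EuclideanSpace ℂ (Fin n)) :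
    ∑ m ∈ Finset.Icc 2 M, 𝒢 m (fun _ => ∑ k ∈ Finset.range (N + 1), Y k) =
      ∑ x ∈ boundedTuples M N, 𝒢 x.1 fun i => Y (x.2 i) := by
  rw [boundedTuples, Finset.sum_sigma]
  exact Finset.sum_congr rfl fun m _ => (𝒢 m).map_sum_finset _ _

/-- A term of order `σ` in the range of `μ` either is collected at one of the indices up to `N`, or
is negligible compared with `t ^ (-ρ)` for all `ρ < μ (N + 1)`. -/
lemma isBigO_sub_sum_ite (hmono : StrictMono μ) {σ : ℝ} (hσ : σ ∈ Set.range μ)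
    {Φ : ℝ → EuclideanSpace ℂ (Fin n)}
    (hΦ : ∀ r : ℝ, -σ < r → Φ =O[atTop] fun t : ℝ => t ^ r) {N : ℕ} {ρ : ℝ} (hρ : ρ < μ (N + 1)) :
    (fun t => Φ t - ∑ k ∈ Finset.range (N + 1), if σ = μ k then Φ t else 0) =O[atTop]
      fun t : ℝ => t ^ (-ρ) := by
  obtain ⟨j, rfl⟩ := hσ
  simp only [hmono.injective.eq_iff, Finset.sum_ite_eq]
  by_cases hj : j ∈ Finset.range (N + 1)
  · simp only [hj, if_true, sub_self]
    exact isBigO_zero _ _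
  · simp only [hj, if_false, sub_zero]
    refine hΦ _ (neg_lt_neg (hρ.trans_le (hmono.monotone ?_)))
    simpa using hj

lemma isBigO_sum_opR_sub_sum_chiTerm (hmono : StrictMono μ) (hν : Monotone ν)
    (hone : ∀ a ∈ Set.range μ, a + 1 ∈ Set.range μ)
    (hq : ∀ k, q k ∈ PClass (EuclideanSpace ℂ (Fin n)) 0 (ν k) (-μ k)) {N : ℕ} {ρ : ℝ}
    (hρ : ρ < μ (N + 1)) :
    (fun t => ∑ k ∈ Finset.range (N + 1), opR (q k) (logVec (ν k) t) -
      ∑ k ∈ Finset.range (N + 1), chiTerm ν μ q k (logVec (ν k) t)) =O[atTop]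
      fun t : ℝ => t ^ (-ρ) := by
  have h1 : ∀ t, ∑ k ∈ Finset.range (N + 1), chiTerm ν μ q k (logVec (ν k) t) =
      ∑ l ∈ Finset.range (N + 1), ∑ k ∈ Finset.range (N + 1),
        if μ l + 1 = μ k then opR (q l) (logVec (ν l) t) else 0 := by
    intro t
    rw [Finset.sum_comm]
    exact Finset.sum_congr rfl fun k hk =>
      chiTerm_logVec hmono hν (Nat.lt_succ_iff.1 (Finset.mem_range.1 hk)) t
  simp only [h1, ← Finset.sum_sub_distrib]
  refine IsBigO.fun_sum fun l _ => isBigO_sub_sum_ite hmono (hone _ ⟨l, rfl⟩) (fun r hr => ?_) hρ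
  exact PClass.isBigO (PClass.opR (hq l)) (by linarith)

lemma sum_mem_range (hadd : ∀ a ∈ Set.range μ, ∀ b ∈ Set.range μ, a + b ∈ Set.range μ) {m : ℕ}
    (hm : 2 ≤ m) (j : Fin m → ℕ) : ∑ i, μ (j i) ∈ Set.range μ := by
  refine Finset.sum_induction_nonempty (fun i => μ (j i)) (· ∈ Set.range μ)
    (fun a b ha hb => hadd a ha b hb) ⟨⟨0, by omega⟩, Finset.mem_univ _⟩ fun i _ => ⟨_, rfl⟩

lemma isBigO_diag_sub_sum_nonlinTerm (hpos : ∀ k, 0 < μ k) (hmono : StrictMono μ)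
    (hν : Monotone ν) (hadd : ∀ a ∈ Set.range μ, ∀ b ∈ Set.range μ, a + b ∈ Set.range μ)
    (hq : ∀ k, q k ∈ PClass (EuclideanSpace ℂ (Fin n)) 0 (ν k) (-μ k)) {M N : ℕ} {ρ : ℝ}
    (hM : μ N ≤ M * μ 0) (hρ : ρ < μ (N + 1)) :
    (fun t => ∑ m ∈ Finset.Icc 2 M,
        𝒢 m (fun _ => ∑ k ∈ Finset.range (N + 1), q k (logVec (ν k) t)) -
      ∑ k ∈ Finset.range (N + 1), nonlinTerm ν μ 𝒢 q k (logVec (ν k) t)) =O[atTop]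
      fun t : ℝ => t ^ (-ρ) := by
  have h1 : ∀ t, ∑ k ∈ Finset.range (N + 1), nonlinTerm ν μ 𝒢 q k (logVec (ν k) t) =
      ∑ x ∈ boundedTuples M N, ∑ k ∈ Finset.range (N + 1), if ∑ i, μ (x.2 i) = μ k then
        𝒢 x.1 fun i => q (x.2 i) (logVec (ν (x.2 i)) t) else 0 := by
    intro t
    rw [Finset.sum_comm]
    exact Finset.sum_congr rfl fun k hk =>
      nonlinTerm_logVec hpos hmono hν (Nat.lt_succ_iff.1 (Finset.mem_range.1 hk)) hM t
  simp only [h1, fun t => multilinear_diag_sum (𝒢 := 𝒢) M N fun k => q k (logVec (ν k) t),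
    ← Finset.sum_sub_distrib]
  refine IsBigO.fun_sum fun x hx => ?_
  rw [boundedTuples, Finset.mem_sigma, Finset.mem_Icc, Fintype.mem_piFinset] at hx
  refine isBigO_sub_sum_ite hmono (sum_mem_range hadd hx.1.1 _) (fun r hr => ?_) hρ
  have hxN : ∀ i, ν (x.2 i) ≤ ν N := fun i =>
    hν (Nat.lt_succ_iff.1 (Finset.mem_range.1 (hx.2 i)))
  have h2 := PClass.isBigO (r := r)
    (PClass.multilinear (𝒢 x.1) fun i => PClass.liftVar (hxN i) (hq (x.2 i)))
    (by rwa [Finset.sum_neg_distrib])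
  refine h2.congr_left fun t => ?_
  congr 1
  funext i
  exact liftVar_logVec (hxN i) _ _

/-- The truncation of the formal solution after index `N` misses the solution `y` by
`O(t ^ (-ρ))`: it satisfies the differential equation up to such an error, and the difference
solves a stable linear equation with a small perturbation. -/
theorem SatisfiesRecursion.hasExpansion {A : Matrix (Fin n) (Fin n) ℂ}
    (hA : ∀ Λ : ℂ, Module.End.HasEigenvalue (Matrix.toEuclideanLin A) Λ → 0 < Λ.re)
    {G : EuclideanSpace ℂ (Fin n) → EuclideanSpace ℂ (Fin n)}
    (hG : ∀ M : ℕ, 2 ≤ M → ∃ δ : ℝ, 0 < δ ∧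
      (fun x => G x - ∑ m ∈ Finset.Icc 2 M, 𝒢 m fun _ => x) =O[𝓝 0]
        fun x => ‖x‖ ^ ((M : ℝ) + δ))
    {f : ℝ → EuclideanSpace ℂ (Fin n)} {fk : ℕ → ℝ → EuclideanSpace ℂ (Fin n)}
    (hν : Monotone ν) (hf : HasExpansion 0 ν μ f fk)
    (hadd : ∀ a ∈ Set.range μ, ∀ b ∈ Set.range μ, a + b ∈ Set.range μ)
    (hone : ∀ a ∈ Set.range μ, a + 1 ∈ Set.range μ)
    {y : ℝ → EuclideanSpace ℂ (Fin n)}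
    (hy : ∀ᶠ t in atTop, HasDerivAt y (-(Matrix.toEuclideanLin A (y t)) + G (y t) + f t) t)
    (hy0 : Tendsto y atTop (𝓝 0))
    (hp : ∀ k, p k ∈ PClass (EuclideanSpace ℂ (Fin n)) 0 (ν k) (-μ k))
    (hfp : ∀ k t, iterExp (ν k) 0 < t → fk k t = p k (logVec (ν k) t))
    (hrec : SatisfiesRecursion A ν μ 𝒢 p q) :
    HasExpansion 0 ν μ y fun k t => q k (logVec (ν k) t) := by
  have hpos := hf.pos
  have hmono := hf.strictMono
  have hq := hrec.mem_PClass hpos hmono hν hp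
  refine ⟨hpos, hmono, hf.tendsto, hf.le, fun k => ⟨q k, hq k, fun _ _ => rfl⟩, fun N => ?_⟩
  obtain ⟨ρf, hρf, hfO⟩ := hf.approx N
  obtain ⟨ρ, hNρ, hρ⟩ := exists_between (lt_min hρf (hmono N.lt_succ_self))
  have hρ1 : ρ < ρf := hρ.trans_le (min_le_left _ _)
  have hρ2 : ρ < μ (N + 1) := hρ.trans_le (min_le_right _ _)
  refine ⟨ρ, hNρ, ?_⟩
  change _ =O[atTop] fun t : ℝ => t ^ (-ρ)
  set s : ℝ → EuclideanSpace ℂ (Fin n) :=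
    fun t => ∑ k ∈ Finset.range (N + 1), q k (logVec (ν k) t) with hs
  have hsO : s =O[atTop] fun t : ℝ => t ^ (-(μ 0 / 2)) := by
    refine IsBigO.fun_sum fun k _ => PClass.isBigO (hq k) ?_
    have := hmono.monotone (Nat.zero_le k)
    linarith [hpos 0]
  have hs0 : Tendsto s atTop (𝓝 0) := hsO.trans_tendsto (tendsto_rpow_neg_atTop (half_pos (hpos 0)))
  -- the degree of the Taylor polynomial of `G` at the origin that is needed for this `N`
  obtain ⟨M, hM⟩ := exists_nat_ge (max 2 (max (ρ / (μ 0 / 2)) (μ N / μ 0)))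
  have hM2 : 2 ≤ M := by exact_mod_cast (le_max_left _ _).trans hM
  have hMρ : ρ ≤ M * (μ 0 / 2) := (div_le_iff₀ (half_pos (hpos 0))).1
    ((le_max_left _ _).trans ((le_max_right _ _).trans hM))
  have hMN : μ N ≤ M * μ 0 := (div_le_iff₀ (hpos 0)).1
    ((le_max_right _ _).trans ((le_max_right _ _).trans hM))
  obtain ⟨δ, hδ, hGM⟩ := hG M hM2
  obtain ⟨R₁, R₂, hR, hR₁, hR₂⟩ := exists_nonlinearity_split hM2 hδ hGM hy0 hs0 hsO hMρ
  have hfO' : (fun t => f t - ∑ k ∈ Finset.range (N + 1), fk k t) =O[atTop]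
      fun t : ℝ => t ^ (-ρ) := hfO.trans (isBigO_rpow_of_le (by linarith))
  have hR₂' := ((hR₂.add (isBigO_diag_sub_sum_nonlinTerm (𝒢 := 𝒢) hpos hmono hν hadd hq hMN
    hρ2)).add hfO').sub (isBigO_sum_opR_sub_sum_chiTerm hmono hν hone hq hρ2)
  refine isBigO_rpow_of_stable (w := fun t => y t - s t) (spectrum_re_pos hA) ?_ hR₁ hR₂'
  have hds : ∀ᶠ t in atTop, ∀ k ∈ Finset.range (N + 1), HasDerivAt (fun t => q k (logVec (ν k) t))
      (-(Matrix.toEuclideanLin A (q k (logVec (ν k) t))) +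
        (nonlinTerm ν μ 𝒢 q k (logVec (ν k) t) + p k (logVec (ν k) t) -
          chiTerm ν μ q k (logVec (ν k) t)) + opR (q k) (logVec (ν k) t)) t :=
    (eventually_all_finset _).2 fun k _ => hasDerivAt_opZ_logVec (g := fun w =>
      nonlinTerm ν μ 𝒢 q k w + p k w - chiTerm ν μ q k w) hA
      (recursion_rhs_mem hpos hmono hν hp fun j _ => hq j) (hrec k)
  have hfk : ∀ᶠ t in atTop, ∀ k ∈ Finset.range (N + 1), fk k t = p k (logVec (ν k) t) :=
    (eventually_all_finset _).2 fun k _ => (eventually_gt_atTop _).mono fun t ht => hfp k t ht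
  filter_upwards [hy, hds, hfk] with t hyt hdt hft
  refine (hyt.sub (HasDerivAt.fun_sum hdt)).congr_deriv ?_
  have hRt := hR t
  rw [sub_eq_iff_eq_add] at hRt
  rw [hRt, Finset.sum_congr rfl hft]
  change _ = -(Matrix.toEuclideanLin A (y t - s t)) + _ + _
  simp only [hs, map_sub, map_sum, Finset.sum_add_distrib, Finset.sum_sub_distrib,
    Finset.sum_neg_distrib]
  abel

end recursion

end PowerDecay

open PowerDecay
theorem theorem8p2 {n : ℕ}
    -- the matrix `A`, all of whose eigenvalues have positive real parts
    (A : Matrix (Fin n) (Fin n) ℂ)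
    (hA : ∀ Λ : ℂ, Module.End.HasEigenvalue (Matrix.toEuclideanLin A) Λ → 0 < Λ.re)
    -- the nonlinearity `G`, with its expansion by homogeneous polynomials at the origin
    (G : EuclideanSpace ℂ (Fin n) → EuclideanSpace ℂ (Fin n))
    (hG : LocallyLipschitz G)
    (Gm : ℕ → EuclideanSpace ℂ (Fin n) → EuclideanSpace ℂ (Fin n))
    (hGm : ∀ m, 2 ≤ m → IsHomogPolyMap m (Gm m))
    (hGexp : ∀ N : ℕ, 2 ≤ N → ∃ δ : ℝ, 0 < δ ∧
      (fun x => G x - ∑ m ∈ Finset.Icc 2 N, Gm m x) =O[𝓝 0] fun x => ‖x‖ ^ ((N : ℝ) + δ))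
    -- the forcing function `f` and its power-decay expansion
    (f : ℝ → EuclideanSpace ℂ (Fin n))
    (hf : ∃ Tf : ℝ, 0 ≤ Tf ∧ ContinuousOn f (Set.Ici Tf))
    (μ : ℕ → ℝ) (ν : ℕ → ℕ) (fk : ℕ → ℝ → EuclideanSpace ℂ (Fin n))
    (hν : Monotone ν)
    (hfexp : HasExpansion 0 ν μ f fk)
    (hadd : ∀ a ∈ Set.range μ, ∀ b ∈ Set.range μ, a + b ∈ Set.range μ)
    (hone : ∀ a ∈ Set.range μ, a + 1 ∈ Set.range μ)
    -- the decaying solution `y`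
    (y : ℝ → EuclideanSpace ℂ (Fin n))
    (hy : ∃ T₀ : ℝ, 0 ≤ T₀ ∧ ContDiffOn ℝ 1 y (Set.Ioi T₀) ∧
      ∀ t, T₀ < t → HasDerivAt y (-(Matrix.toEuclideanLin A (y t)) + G (y t) + f t) t)
    (hy0 : Tendsto y atTop (𝓝 0)) :
    (∃ yk : ℕ → ℝ → EuclideanSpace ℂ (Fin n), HasExpansion 0 ν μ y yk) ∧
    ∀ (𝒢 : ∀ m : ℕ, MultilinearMap ℂ (fun _ : Fin m => EuclideanSpace ℂ (Fin n))
        (EuclideanSpace ℂ (Fin n)))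
      (_ : ∀ m, 2 ≤ m → ∀ x, Gm m x = 𝒢 m fun _ => x)
      (p : ∀ k : ℕ, (Fin (ν k + 2) → ℝ) → EuclideanSpace ℂ (Fin n))
      (_ : ∀ k, p k ∈ PClass (EuclideanSpace ℂ (Fin n)) 0 (ν k) (-μ k))
      (_ : ∀ k t, iterExp (ν k) 0 < t → fk k t = p k (logVec (ν k) t)),
      (∃ q : ∀ k : ℕ, (Fin (ν k + 2) → ℝ) → EuclideanSpace ℂ (Fin n),
        SatisfiesRecursion A ν μ 𝒢 p q) ∧
      ∀ q : ∀ k : ℕ, (Fin (ν k + 2) → ℝ) → EuclideanSpace ℂ (Fin n),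
        SatisfiesRecursion A ν μ 𝒢 p q →
          (∀ k, q k ∈ PClass (EuclideanSpace ℂ (Fin n)) 0 (ν k) (-μ k)) ∧
          HasExpansion 0 ν μ y fun k t => q k (logVec (ν k) t) := by
  obtain ⟨T₀, -, -, hy'⟩ := hy
  have hyev := (eventually_gt_atTop T₀).mono hy'
  have main : ∀ (𝒢 : ∀ m : ℕ, MultilinearMap ℂ (fun _ : Fin m => EuclideanSpace ℂ (Fin n))
        (EuclideanSpace ℂ (Fin n)))
      (_ : ∀ m, 2 ≤ m → ∀ x, Gm m x = 𝒢 m fun _ => x)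
      (p : ∀ k : ℕ, (Fin (ν k + 2) → ℝ) → EuclideanSpace ℂ (Fin n))
      (_ : ∀ k, p k ∈ PClass (EuclideanSpace ℂ (Fin n)) 0 (ν k) (-μ k))
      (_ : ∀ k t, iterExp (ν k) 0 < t → fk k t = p k (logVec (ν k) t)),
      (∃ q : ∀ k : ℕ, (Fin (ν k + 2) → ℝ) → EuclideanSpace ℂ (Fin n),
        SatisfiesRecursion A ν μ 𝒢 p q) ∧
      ∀ q : ∀ k : ℕ, (Fin (ν k + 2) → ℝ) → EuclideanSpace ℂ (Fin n),
        SatisfiesRecursion A ν μ 𝒢 p q →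
          (∀ k, q k ∈ PClass (EuclideanSpace ℂ (Fin n)) 0 (ν k) (-μ k)) ∧
          HasExpansion 0 ν μ y fun k t => q k (logVec (ν k) t) := by
    intro 𝒢 h𝒢 p hp hfp
    refine ⟨exists_satisfiesRecursion A hfexp.pos hfexp.strictMono p, fun q hq =>
      ⟨hq.mem_PClass hfexp.pos hfexp.strictMono hν hp,
        hq.hasExpansion hA (fun M hM => ?_) hν hfexp hadd hone hyev hy0 hp hfp⟩⟩
    obtain ⟨δ, hδ, h⟩ := hGexp M hM
    refine ⟨δ, hδ, h.congr_left fun x => ?_⟩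
    rw [Finset.sum_congr rfl fun m hm => h𝒢 m (Finset.mem_Icc.1 hm).1 x]
  refine ⟨?_, main⟩
  choose! 𝒢 h𝒢 using fun m (hm : 2 ≤ m) => (hGm m hm).exists_multilinear
  choose p hp hfp using hfexp.mem
  obtain ⟨⟨q, hq⟩, h⟩ := main 𝒢 h𝒢 p hp hfp
  exact ⟨_, (h q hq).2⟩
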